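/- **Conventions.** All graphs are finite, simple and undirected and all groups are finite. *Weisfeiler--Leman.* For a finite structure $A$ and an initial colouring $\chi_0$ of $A^k$, the counting $k$-dimensional Weisfeiler--Leman algorithm computes, for $r\ge 0$ and $\bar a=(a_1,\dots,a_k)\in A^k$, $$\chi_{r+1}(\bar a)=\Bigl(\chi_r(\bar a),\ \{\!\!\{(\chi_r(\bar a(a_1/x)),\dots,\chi_r(\bar a(a_k/x))) : x\in A\}\!\!\}\Bigr),$$ where $\bar a(a_i/x)$ is $\bar a$ with its $i$-th entry replaced by $x$. For graphs, $\chi_0(\bar v)=\chi_0(\bar u)$ iff for all $i,j$: $v_i=v_j\Leftrightarrow u_i=u_j$, and $v_iv_j$ is an edge iff $u_iu_j$ is an edge. For groups (Version I), $\chi_0(\bar g)=\chi_0(\bar h)$ iff for all $i,j,\ell$: $g_i=g_j\Leftrightarrow h_i=h_j$, and $g_ig_j=g_\ell\Leftrightarrow h_ih_j=h_\ell$. The $(k,r)$-WL algorithm *distinguishes* $A$ from $B$ if the multisets $\{\!\!\{\chi_r(\bar a):\bar a\in A^k\}\!\!\}$ and $\{\!\!\{\chi_r(\bar b):\bar b\in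 B^k\}\!\!\}$ differ; it *identifies* a graph (group) $A$ if it distinguishes $A$ from every finite graph (group) not isomorphic to $A$. *CFI graphs.* Given a graph $\Gamma_0$, $\mathrm{CFI}(\Gamma_0)$ is built as follows. For each vertex $v$ take a gadget consisting of external vertices $a^v_w,b^v_w$, one pair for each neighbour $w$ of $v$, and internal vertices labelled by the $0$-$1$-strings $s$ with an even number of ones, indexed by the neighbours of $v$; the internal vertex $s$ is adjacent to $a^v_w$ if $s_w=0$ and to $b^v_w$ if $s_w=1$. For each edge $vw$ of $\Gamma_0$ add the edges $a^v_wa^w_v$ and $b^v_wb^w_v$. The twisted graph $\widetilde{\mathrm{CFI}}(\Gamma_0)$ is obtained by choosing one edge $vw$ of $\Gamma_0$ and replacing $a^v_wa^w_v,\ b^v_wb^w_v$ by $a^v_wb^w_v,\ b^v_wa^w_v$. *Mekler groups.* For a graph $\Gamma$ and a prime $p>2$, $$G_\Gamma=\langle x_v\ (v\in V(\Gamma))\mid x_v^p=1,\ [[x_u,x_v],x_w]=1\ (u,v,w\in V(\Gamma)),\ [x_u,x_v]=1\ (uv\in E(\Gamma))\rangle .$$ **Theorem.** There is a function $f:\mathbb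 N\to\mathbb N$ with $f(n)=O(\log\log n)$ such that the following holds for every prime $p>2$, every connected $3$-regular graph $\Gamma_0$ and every choice of the twisted edge. Let $\Gamma_1=\mathrm{CFI}(\Gamma_0)$, $\Gamma_2=\widetilde{\mathrm{CFI}}(\Gamma_0)$, and $G_i=G_{\Gamma_i}$ for $i=1,2$. 1. The counting $(3,f(|G_1|))$-WL Version I algorithm distinguishes $G_1$ from $G_2$. 2. If $r\ge 0$ and $\Gamma_0$ is identified by the counting graph $(3,r)$-WL algorithm, then for $i=1,2$ the counting $(3,\max\{r,f(|G_i|)\})$-WL Version I algorithm identifies $G_i$ among all finite groups. -/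

import Mathlib

open scoped commutatorElement

/-! ### The Weisfeiler--Leman colouring -/

/-- Colours after `r` rounds of the `k`-dimensional algorithm, with initial colours in `I`. -/
def WLColor (I : Type) (k : ℕ) : ℕ → Type
  | 0 => I
  | r + 1 => WLColor I k r × Multiset (Fin k → WLColor I k r)

/-- The counting `k`-dimensional Weisfeiler--Leman colouring of `k`-tuples after `r` rounds:
`χ_{r+1}(v) = (χ_r(v), {{(χ_r(v(v₁/x)), …, χ_r(v(v_k/x))) | x}})`. -/
def wlColor {A : Type*} {I : Type} [Fintype A] {k : ℕ} (χ₀ : (Fin k → A) → I) :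
    (r : ℕ) → (Fin k → A) → WLColor I k r
  | 0, v => χ₀ v
  | r + 1, v => (wlColor χ₀ r v,
      Finset.univ.val.map fun (x : A) (i : Fin k) => wlColor χ₀ r (Function.update v i x))

/-- The multiset of the colours of all `k`-tuples after `r` rounds. -/
def wlColors {A : Type*} {I : Type} [Fintype A] {k : ℕ} (χ₀ : (Fin k → A) → I) (r : ℕ) :
    Multiset (WLColor I k r) :=
  Finset.univ.val.map (wlColor χ₀ r)

/-- Initial colour of a tuple of vertices: its equality and adjacency pattern, that is, the
isomorphism type of the induced subgraph marked by the tuple. -/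
def graphInitialColor {V : Type*} (Γ : SimpleGraph V) (k : ℕ) (v : Fin k → V) :
    (Fin k → Fin k → Prop) × (Fin k → Fin k → Prop) :=
  (fun i j => v i = v j, fun i j => Γ.Adj (v i) (v j))

/-- Initial colour of a tuple of group elements in Version I: its equality and
multiplication pattern. -/
def groupInitialColor (G : Type*) [Group G] (k : ℕ) (g : Fin k → G) :
    (Fin k → Fin k → Prop) × (Fin k → Fin k → Fin k → Prop) :=
  (fun i j => g i = g j, fun i j l => g i * g j = g l)

/-- The graph `(k, r)`-WL distinguishes two finite graphs. -/
def GraphWLDistinguishes (k r : ℕ) {V W : Type*} [Fintype V] [Fintype W]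
    (Γ : SimpleGraph V) (Δ : SimpleGraph W) : Prop :=
  wlColors (graphInitialColor Γ k) r ≠ wlColors (graphInitialColor Δ k) r

/-- The counting `(k, r)`-WL Version I distinguishes two finite groups. -/
def GroupWLDistinguishes (k r : ℕ) (G H : Type*) [Group G] [Fintype G] [Group H] [Fintype H] :
    Prop :=
  wlColors (groupInitialColor G k) r ≠ wlColors (groupInitialColor H k) r

/-- The graph `(k, r)`-WL identifies `Γ`: it distinguishes `Γ` from every finite graph that is
not isomorphic to it. -/
def GraphWLIdentifies.{u} (k r : ℕ) {V : Type u} [Fintype V] (Γ : SimpleGraph V) : Prop :=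
  ∀ (W : Type u) [Fintype W] (Δ : SimpleGraph W),
    IsEmpty (Γ ≃g Δ) → GraphWLDistinguishes k r Γ Δ

/-- The counting `(k, r)`-WL Version I identifies `G`: it distinguishes `G` from every finite
group that is not isomorphic to it. -/
def GroupWLIdentifies.{u} (k r : ℕ) (G : Type u) [Group G] [Fintype G] : Prop :=
  ∀ (H : Type u) [Group H] [Fintype H],
    IsEmpty (G ≃* H) → GroupWLDistinguishes k r G H

/-! ### CFI graphs -/

/-- Vertices of the CFI graphs over `Γ`. External vertices: `inl (d, false)` and `inl (d, true)`
are the vertices `a` and `b` of the gadget at `d.fst` belonging to its edge towards `d.snd`.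
Internal vertices: `inr ⟨(v, s), _⟩` is the internal vertex of the gadget at `v` labelled by the
`0`-`1`-string on the edges at `v` whose ones are at the neighbours in `s`; the number of
ones is even. -/
abbrev CFIVertex {V : Type*} (Γ : SimpleGraph V) : Type _ :=
  (Γ.Dart × Bool) ⊕ {x : V × Finset V // (∀ w ∈ x.2, Γ.Adj x.1 w) ∧ Even x.2.card}

instance cfiVertexFinite {V : Type*} [Finite V] (Γ : SimpleGraph V) : Finite (CFIVertex Γ) :=
  haveI : Finite Γ.Dart := Finite.of_injective _ SimpleGraph.Dart.toProd_injective
  inferInstance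

/-- Adjacency of an internal vertex and an external vertex of the same gadget. -/
def cfiInner {V : Type*} (Γ : SimpleGraph V)
    (m : {x : V × Finset V // (∀ w ∈ x.2, Γ.Adj x.1 w) ∧ Even x.2.card})
    (o : Γ.Dart × Bool) : Prop :=
  o.1.fst = m.1.1 ∧ (o.2 = true ↔ o.1.snd ∈ m.1.2)

/-- The CFI graph over `Γ` in which exactly the base edges in `T` are twisted. -/
def cfiTwist {V : Type*} (Γ : SimpleGraph V) (T : Set (Sym2 V)) : SimpleGraph (CFIVertex Γ) where
  Adj
    | .inl o, .inl o' => o'.1 = o.1.symm ∧ (o.2 ≠ o'.2 ↔ o.1.edge ∈ T)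
    | .inl o, .inr m => cfiInner Γ m o
    | .inr m, .inl o => cfiInner Γ m o
    | .inr _, .inr _ => False
  symm := ⟨by
    rintro (⟨d, b⟩ | m) (⟨d', b'⟩ | m') h
    · obtain ⟨h₁, h₂⟩ := h
      dsimp only at h₁ h₂
      subst h₁
      exact ⟨by simp, by simpa [ne_comm] using h₂⟩
    · exact h
    · exact h
    · exact h⟩
  loopless := ⟨by
    rintro (⟨d, b⟩ | m) h
    · exact d.symm_ne h.1.symm
    · exact h⟩

/-- The graph `CFI(Γ)`. -/
def cfi {V : Type*} (Γ : SimpleGraph V) : SimpleGraph (CFIVertex Γ) := cfiTwist Γ ∅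

/-- The twisted CFI graph, with the twist at the base edge `e`. -/
def twistedCfi {V : Type*} (Γ : SimpleGraph V) (e : Sym2 V) : SimpleGraph (CFIVertex Γ) :=
  cfiTwist Γ {e}

/-! ### Mekler's construction -/

/-- The relators of Mekler's construction. -/
def meklerRels {X : Type*} (p : ℕ) (Γ : SimpleGraph X) : Set (FreeGroup X) :=
  {w | ∃ i : X, w = FreeGroup.of i ^ p} ∪
  {w | ∃ i j l : X, w = ⁅⁅FreeGroup.of i, FreeGroup.of j⁆, FreeGroup.of l⁆} ∪
  {w | ∃ i j : X, Γ.Adj i j ∧ w = ⁅FreeGroup.of i, FreeGroup.of j⁆}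

/-- The group `G_Γ` of Mekler's construction at the prime `p`. -/
abbrev MeklerGroup {X : Type*} (p : ℕ) (Γ : SimpleGraph X) : Type _ :=
  PresentedGroup (meklerRels p Γ)

theorem commGroup_finite_of_closure {A : Type*} [CommGroup A] {S : Set A} (hS : S.Finite)
    (hc : Subgroup.closure S = ⊤) (ht : ∀ x ∈ S, IsOfFinOrder x) : Finite A := by
  have : Group.FG A := ⟨⟨hS.toFinset, by simpa using hc⟩⟩
  refine CommGroup.finite_of_fg_isMulTorsion A fun x => ?_
  have h : Subgroup.closure S ≤ CommGroup.torsion A := (Subgroup.closure_le _).2 ht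
  rw [hc] at h
  exact h (Subgroup.mem_top x)

theorem finite_of_closure_of_commutator_central {G : Type*} [Group G] {S : Set G}
    (hS : S.Finite) (hc : Subgroup.closure S = ⊤) (ht : ∀ x ∈ S, IsOfFinOrder x)
    (hz : ∀ x ∈ S, ∀ y ∈ S, ⁅x, y⁆ ∈ Subgroup.center G) : Finite G := by
  have key : ∀ N : Subgroup G, ∀ _ : N.Normal, (∀ x ∈ S, ∀ y ∈ S, ⁅x, y⁆ ∈ N) →
      Finite (G ⧸ N) := by
    intro N _ hN
    have hcl : Subgroup.closure (QuotientGroup.mk' N '' S) = ⊤ := by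
      rw [← MonoidHom.map_closure, hc, Subgroup.map_top_of_surjective _
        (QuotientGroup.mk'_surjective N)]
    have h1 : ∀ x ∈ QuotientGroup.mk' N '' S, ∀ y ∈ QuotientGroup.mk' N '' S, y * x = x * y := by
      rintro _ ⟨x, hx, rfl⟩ _ ⟨y, hy, rfl⟩
      rw [eq_comm, ← commutatorElement_eq_one_iff_mul_comm, ← map_commutatorElement]
      exact (QuotientGroup.eq_one_iff _).2 (hN x hx y hy)
    have h2 : ∀ x ∈ QuotientGroup.mk' N '' S, ∀ y, x * y = y * x := by
      intro x hx y
      have : Subgroup.closure (QuotientGroup.mk' N '' S) ≤ Subgroup.centralizer {x} := by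
        rw [Subgroup.closure_le]
        intro y hy
        exact Subgroup.mem_centralizer_singleton_iff.2 (h1 x hx y hy)
      rw [hcl] at this
      exact (Subgroup.mem_centralizer_singleton_iff.1 (this (Subgroup.mem_top y))).symm
    have h3 : ∀ x y : G ⧸ N, x * y = y * x := by
      intro x y
      have : Subgroup.closure (QuotientGroup.mk' N '' S) ≤ Subgroup.centralizer {y} := by
        rw [Subgroup.closure_le]
        intro x hx
        exact Subgroup.mem_centralizer_singleton_iff.2 (h2 x hx y)
      rw [hcl] at this
      exact Subgroup.mem_centralizer_singleton_iff.1 (this (Subgroup.mem_top x))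
    let _ : CommGroup (G ⧸ N) := { (inferInstance : Group (G ⧸ N)) with mul_comm := h3 }
    refine commGroup_finite_of_closure (hS.image (QuotientGroup.mk' N)) hcl ?_
    rintro _ ⟨x, hx, rfl⟩
    exact MonoidHom.isOfFinOrder _ (ht x hx)
  have hZ := key (Subgroup.center G) inferInstance hz
  have : Finite (commutatorSet G) := by
    let φ : (G ⧸ Subgroup.center G) × (G ⧸ Subgroup.center G) → G :=
      fun q => ⁅q.1.out, q.2.out⁆
    refine Set.Finite.subset (Set.finite_range φ) ?_
    rintro _ ⟨a, b, rfl⟩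
    refine ⟨(a, b), ?_⟩
    obtain ⟨z, hz⟩ := QuotientGroup.mk_out_eq_mul (Subgroup.center G) a
    obtain ⟨w, hw⟩ := QuotientGroup.mk_out_eq_mul (Subgroup.center G) b
    have hz' := Subgroup.mem_center_iff.1 z.2
    have hw' := Subgroup.mem_center_iff.1 w.2
    simp only [φ, hz, hw, commutatorElement_def, mul_inv_rev]
    calc a * z * (b * w) * ((z : G)⁻¹ * a⁻¹) * ((w : G)⁻¹ * b⁻¹)
        = a * (z * (b * w)) * (z : G)⁻¹ * a⁻¹ * (w : G)⁻¹ * b⁻¹ := by group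
      _ = a * b * (w * a⁻¹) * (w : G)⁻¹ * b⁻¹ := by rw [← hz']; group
      _ = a * b * a⁻¹ * b⁻¹ := by rw [← hw']; group
  have hQ := key (commutator G) inferInstance fun x _ y _ =>
    Subgroup.commutator_mem_commutator (Subgroup.mem_top x) (Subgroup.mem_top y)
  exact Finite.of_subgroup_quotient (commutator G)

/-- Mekler groups of finite graphs are finite. -/
theorem meklerGroup_finite {X : Type*} [Finite X] {p : ℕ} (hp : 0 < p) (Γ : SimpleGraph X) :
    Finite (MeklerGroup p Γ) := by
  have hrel : ∀ w ∈ meklerRels p Γ, PresentedGroup.mk (meklerRels p Γ) w = 1 :=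
    fun w hw => PresentedGroup.one_of_mem hw
  refine finite_of_closure_of_commutator_central (Set.finite_range PresentedGroup.of)
    (PresentedGroup.closure_range_of (meklerRels p Γ)) ?_ ?_
  · rintro _ ⟨i, rfl⟩
    refine isOfFinOrder_iff_pow_eq_one.2 ⟨p, hp, ?_⟩
    have h := hrel _ (Or.inl (Or.inl ⟨i, rfl⟩))
    rw [map_pow] at h
    exact h
  · rintro _ ⟨i, rfl⟩ _ ⟨j, rfl⟩
    rw [Subgroup.mem_center_iff]
    intro g
    have : Subgroup.closure (Set.range (PresentedGroup.of (rels := meklerRels p Γ))) ≤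
        Subgroup.centralizer {⁅(PresentedGroup.of i : MeklerGroup p Γ), (PresentedGroup.of j : MeklerGroup p Γ)⁆} := by
      rw [Subgroup.closure_le]
      rintro _ ⟨l, rfl⟩
      refine Subgroup.mem_centralizer_singleton_iff.2 ?_
      have h := hrel _ (Or.inl (Or.inr ⟨i, j, l, rfl⟩))
      rw [map_commutatorElement, map_commutatorElement,
        commutatorElement_eq_one_iff_mul_comm] at h
      exact h.symm
    rw [PresentedGroup.closure_range_of] at this
    exact Subgroup.mem_centralizer_singleton_iff.1 (this (Subgroup.mem_top g))

noncomputable instance meklerGroupFintype {X : Type*} [Finite X] {p : ℕ} [hp : Fact p.Prime]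
    (Γ : SimpleGraph X) : Fintype (MeklerGroup p Γ) :=
  haveI := meklerGroup_finite hp.out.pos Γ
  Fintype.ofFinite _

open scoped Pointwise

universe u

/-! ### The pebble game -/

/-! Equality of colours is played as a bijective pebble game with four elements on the board, and
`WLInvariant r` collects the predicates that `r` rounds preserve. Two devices keep the number of
rounds small: products of `j` elements of a definable set are recognised by halving
(`WLInvariant.pow`, about `2 log j` rounds), and powers with exponent up to `p` by splitting the
exponent at a square root (`WLInvariant.eq_pow`, about `3 log log p` rounds). For a graph with `n`
vertices the group has order at least `p ^ n`, so `log n` and `log log p` are both bounded by `log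
log |G|`.

The core is `nonempty_mulEquiv_of_wlColors_eq`. Suppose `G` contains an element `c` over which every
vertex is definable: a formula with parameter `c` holds exactly for the elements `x_v ^ d * z` with
`d ≠ 0` and `z` central, the line of `v`. If `H` has the same colours as `G`, then `c` has a partner
`c'`, and relative to it each `x_v` has a partner `y_v`. The `y_v` satisfy Mekler's relations, they
generate `H` modulo its centre, and the centre of `H` consists of products of commutators. So `x_v ↦
y_v` extends to a surjective homomorphism between groups of equal order.

To find `c`, note first that in a graph of minimal degree two without triangles and squares the
lines are the non-central elements with large centralizers (`isVertexLike_iff`). Let `c` be the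
product of the commutators `⁅x_u, x_v⁆` over the edges of an auxiliary graph on the vertices, all of
them non-edges of the given graph. Dividing `c` by a commutator of two line elements shortens it
exactly when that commutator is one of its factors (`linked_code_iff`), so auxiliary degrees can be
counted in the group. The auxiliary graph is a threshold graph on the internal vertices of the CFI
graph: its degrees there are positive and distinct except for one pair of twins. The twins differ in
their distance to a third vertex, and an external vertex is determined by two internal neighbours
because there are no squares (`atVertex_iff`).

Commutation of lines recovers the graph from its Mekler group
(`MeklerModel.nonempty_iso_of_mulEquiv`), so distinguishing the two groups reduces to
`isEmpty_cfi_iso_twistedCfi`, a parity count over the edges of the base graph. -/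

theorem vec_comp_of_forall_ne {K : Type*} (c : Fin 4 → K) (y : K) {π : Fin 3 → Fin 4} {i : Fin 3}
    (hi : ∀ l, π l ≠ i.castSucc) : ![c 0, c 1, c 2, y] ∘ π =
      Function.update (c ∘ ![0, 1, 2]) i y ∘
        fun l => if h : π l = 3 then i else (π l).castPred h := by
  funext l
  have := hi l
  by_cases hl : π l = 3
  · simp [hl]
  · obtain ⟨k, hk⟩ := Fin.exists_castSucc_eq.2 hl
    have hki : k ≠ i := fun hki => this (by rw [← hk, hki])
    have hpred : ∀ h, (π l).castPred h = k := fun h => by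
      apply Fin.castSucc_injective; rw [Fin.castSucc_castPred, hk]
    change ![c 0, c 1, c 2, y] (π l) = Function.update (c ∘ ![0, 1, 2]) i y (dite _ _ _)
    rw [dif_neg hl, hpred, Function.update_of_ne hki, ← hk]
    fin_cases k <;> rfl

theorem vec_comp_of_forall_ne_last {K : Type*} (c : Fin 4 → K) (y : K) {π : Fin 3 → Fin 4}
    (hi : ∀ l, π l ≠ 3) : ![c 0, c 1, c 2, y] ∘ π =
      (c ∘ ![0, 1, 2]) ∘ fun l => (π l).castPred (hi l) := by
  funext l
  obtain ⟨k, hk⟩ := Fin.exists_castSucc_eq.2 (hi l)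
  have hpred : ∀ h, (π l).castPred h = k := fun h => by
    apply Fin.castSucc_injective; rw [Fin.castSucc_castPred, hk]
  change ![c 0, c 1, c 2, y] (π l) = (c ∘ ![0, 1, 2]) ((π l).castPred _)
  rw [hpred, ← hk]
  fin_cases k <;> rfl

theorem update_comp_of_forall_ne {K : Type*} (c : Fin 3 → K) (y : K) {π : Fin 3 → Fin 3}
    {i j : Fin 3} (hj : ∀ l, l ≠ i → π l ≠ j) :
    Function.update (c ∘ π) i y = Function.update c j y ∘ Function.update π i j := by
  funext l
  by_cases hl : l = i
  · subst hl; simp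
  · simp [Function.update_of_ne hl, Function.update_of_ne (hj l hl)]

theorem vec_four_eta {K : Type*} (t : Fin 4 → K) : ![t 0, t 1, t 2, t 3] = t := by
  funext i
  fin_cases i <;> rfl

/-- Equal multisets have fibres of equal size, and bijections of the fibres glue. This turns the
multiset in a refinement step into a move of the bijective pebble game. -/
theorem exists_equiv_of_map_univ_eq {A B C : Type*} [Fintype A] [Fintype B] {f : A → C} {g : B → C}
    (h : (Finset.univ.val.map f : Multiset C) = Finset.univ.val.map g) :
    ∃ σ : A ≃ B, ∀ x, f x = g (σ x) := by
  classical
  have hc : ∀ y : C, Nonempty ({a // f a = y} ≃ {b // g b = y}) := by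
    intro y
    refine ⟨Fintype.equivOfCardEq ?_⟩
    have := congrArg (Multiset.count y) h
    rw [Multiset.count_map, Multiset.count_map] at this
    rw [Fintype.card_subtype, Fintype.card_subtype]
    simpa [Finset.card, Finset.filter_val, eq_comm] using this
  refine ⟨Equiv.ofFiberEquiv fun y => (hc y).some, fun x => ?_⟩
  exact (Equiv.ofFiberEquiv_map (fun y => (hc y).some) x).symm

theorem map_univ_eq_of_equiv {A B C : Type*} [Fintype A] [Fintype B] {f : A → C} {g : B → C}
    (σ : A ≃ B) (h : ∀ x, f x = g (σ x)) :
    (Finset.univ.val.map f : Multiset C) = Finset.univ.val.map g := by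
  have : f = g ∘ σ := funext h
  rw [this, ← Multiset.map_map, Multiset.map_univ_val_equiv]

/-- Two triples of group elements that get the same colour after `r` rounds. -/
def SameColor (r : ℕ) {G H : Type*} [Group G] [Fintype G] [Group H] [Fintype H]
    (a : Fin 3 → G) (b : Fin 3 → H) : Prop :=
  wlColor (groupInitialColor G 3) r a = wlColor (groupInitialColor H 3) r b

namespace SameColor

variable {G H : Type*} [Group G] [Fintype G] [Group H] [Fintype H] {r : ℕ}
  {a : Fin 3 → G} {b : Fin 3 → H}

theorem symm (h : SameColor r a b) : SameColor r b a := Eq.symm h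

theorem of_succ (h : SameColor (r + 1) a b) : SameColor r a b := congrArg Prod.fst h

theorem mono {s : ℕ} (hs : s ≤ r) (h : SameColor r a b) : SameColor s a b := by
  induction r, hs using Nat.le_induction with
  | base => exact h
  | succ n _ ih => exact ih h.of_succ

theorem exists_equiv (h : SameColor (r + 1) a b) :
    ∃ σ : G ≃ H, ∀ x i, SameColor r (Function.update a i x) (Function.update b i (σ x)) := by
  obtain ⟨σ, hσ⟩ := exists_equiv_of_map_univ_eq (congrArg Prod.snd h)
  exact ⟨σ, fun x i => congrFun (hσ x) i⟩

theorem succ_of_equiv (h : SameColor r a b) (σ : G ≃ H)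
    (hσ : ∀ x i, SameColor r (Function.update a i x) (Function.update b i (σ x))) :
    SameColor (r + 1) a b :=
  Prod.ext h (map_univ_eq_of_equiv σ fun x => funext fun i => hσ x i)

theorem eq_iff (h : SameColor 0 a b) (i j : Fin 3) : a i = a j ↔ b i = b j :=
  iff_of_eq (congrFun (congrFun (congrArg Prod.fst h) i) j)

theorem mul_iff (h : SameColor 0 a b) (i j l : Fin 3) : a i * a j = a l ↔ b i * b j = b l :=
  iff_of_eq (congrFun (congrFun (congrFun (congrArg Prod.snd h) i) j) l)

/-- To follow an update of entry `i` of `a ∘ π`, update `a` at an index `j` that `π` does not read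
at the other two positions; two positions cannot exhaust three indices. -/
theorem comp (π : Fin 3 → Fin 3) (h : SameColor r a b) : SameColor r (a ∘ π) (b ∘ π) := by
  induction r generalizing a b π with
  | zero =>
    refine Prod.ext ?_ ?_
    · funext i j
      exact propext (h.eq_iff (π i) (π j))
    · funext i j l
      exact propext (h.mul_iff (π i) (π j) (π l))
  | succ r ih =>
    obtain ⟨σ, hσ⟩ := h.exists_equiv
    refine succ_of_equiv (ih π h.of_succ) σ fun x i => ?_
    have hj : ∃ j, ∀ l, l ≠ i → π l ≠ j := by
      revert i π
      clear * -
      decide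
    obtain ⟨j, hj⟩ := hj
    rw [update_comp_of_forall_ne a x hj, update_comp_of_forall_ne b (σ x) hj]
    exact ih _ (hσ x j)

end SameColor

/-- Two quadruples all of whose corresponding subtriples get the same colour after `r` rounds. -/
def Pebble (r : ℕ) {G H : Type*} [Group G] [Fintype G] [Group H] [Fintype H]
    (t : Fin 4 → G) (s : Fin 4 → H) : Prop :=
  ∀ π : Fin 3 → Fin 4, SameColor r (t ∘ π) (s ∘ π)

namespace Pebble

variable {G H : Type*} [Group G] [Fintype G] [Group H] [Fintype H] {r : ℕ}
  {t : Fin 4 → G} {s : Fin 4 → H}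

theorem symm (h : Pebble r t s) : Pebble r s t := fun π => (h π).symm

theorem mono {r' : ℕ} (hr : r' ≤ r) (h : Pebble r t s) : Pebble r' t s :=
  fun π => (h π).mono hr

theorem comp (π : Fin 4 → Fin 4) (h : Pebble r t s) : Pebble r (t ∘ π) (s ∘ π) :=
  fun ρ => h (π ∘ ρ)

theorem eq_iff (h : Pebble r t s) (i j : Fin 4) : t i = t j ↔ s i = s j := by
  simpa using ((h ![i, j, i]).mono (Nat.zero_le r)).eq_iff 0 1

theorem mul_iff (h : Pebble r t s) (i j l : Fin 4) : t i * t j = t l ↔ s i * s j = s l := by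
  simpa using ((h ![i, j, l]).mono (Nat.zero_le r)).mul_iff 0 1 2

/-- The bijection answers moves on the first triple. A subtriple of the new quadruple either omits
one of the old indices, and then it rearranges an updated triple, or it reads all three of them and
does not see the new element. -/
theorem exists_equiv (h : Pebble (r + 1) t s) :
    ∃ σ : G ≃ H, ∀ x, Pebble r ![t 0, t 1, t 2, x] ![s 0, s 1, s 2, σ x] := by
  obtain ⟨σ, hσ⟩ := (h ![0, 1, 2]).exists_equiv
  refine ⟨σ, fun x π => ?_⟩
  by_cases hi : ∃ i : Fin 3, ∀ l, π l ≠ i.castSucc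
  · obtain ⟨i, hi⟩ := hi
    rw [vec_comp_of_forall_ne t x hi, vec_comp_of_forall_ne s (σ x) hi]
    exact (hσ x i).comp _
  · push Not at hi
    choose l hl using hi
    have hinj : Function.Injective l := fun i j hij =>
      Fin.castSucc_injective _ (by rw [← hl i, ← hl j, hij])
    have hlast : ∀ k, π k ≠ 3 := fun k => by
      obtain ⟨i, rfl⟩ := Finite.surjective_of_injective hinj k
      rw [hl]
      exact Fin.castSucc_ne_last i
    rw [vec_comp_of_forall_ne_last t x hlast, vec_comp_of_forall_ne_last s (σ x) hlast]
    exact (h ![0, 1, 2]).of_succ.comp _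

theorem of_wlColors_eq (h : wlColors (groupInitialColor G 3) r = wlColors (groupInitialColor H 3) r)
    (c : G) : ∃ c' : H, Pebble r (fun _ => c) fun _ => c' := by
  obtain ⟨σ, hσ⟩ := exists_equiv_of_map_univ_eq h
  have h1 : SameColor r (fun _ => c) (σ fun _ => c) := hσ _
  have h2 : (σ fun _ => c) = fun _ => (σ fun _ => c) 0 := by
    funext i
    exact ((h1.mono (Nat.zero_le r)).eq_iff i 0).1 rfl
  rw [h2] at h1
  exact ⟨_, fun π => h1⟩

end Pebble

theorem wlColors_congr {G H : Type*} [Group G] [Fintype G] [Group H] [Fintype H] (e : G ≃* H)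
    (r : ℕ) : wlColors (groupInitialColor G 3) r = wlColors (groupInitialColor H 3) r := by
  have key : ∀ r (a : Fin 3 → G), SameColor r a (e ∘ a) := by
    intro r
    induction r with
    | zero =>
      intro a
      refine Prod.ext ?_ ?_
      · funext i j
        exact propext (e.injective.eq_iff).symm
      · funext i j l
        refine propext ?_
        change a i * a j = a l ↔ e (a i) * e (a j) = e (a l)
        rw [← map_mul, e.injective.eq_iff]
    | succ r ih =>
      intro a
      refine SameColor.succ_of_equiv (ih a) e.toEquiv fun x i => ?_
      have : Function.update (e ∘ a) i (e x) = e ∘ Function.update a i x := by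
        rw [Function.comp_update]
      exact (congrArg (SameColor r _) this).mpr (ih _)
  exact map_univ_eq_of_equiv (Equiv.arrowCongr (Equiv.refl (Fin 3)) e.toEquiv) fun a => key r a

/-! ### Invariant predicates -/

/-- A predicate on quadruples of elements of finite groups. -/
abbrev GroupPred : Type (u + 1) :=
  ∀ (G : Type u) [Group G] [Fintype G], G → G → G → G → Prop

/-- A predicate is invariant of rank `r` if it is preserved by `Pebble r`; this holds for the
predicates defined by counting formulas with four variables and quantifier depth `r`. -/
def WLInvariant (r : ℕ) (Q : GroupPred.{u}) : Prop :=
  ∀ (G H : Type u) [Group G] [Fintype G] [Group H] [Fintype H] (t : Fin 4 → G) (s : Fin 4 → H),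
    Pebble r t s → Q G (t 0) (t 1) (t 2) (t 3) → Q H (s 0) (s 1) (s 2) (s 3)

namespace WLInvariant

variable {r : ℕ} {Q Q' : GroupPred.{u}}

theorem iff (h : WLInvariant r Q) {G H : Type u} [Group G] [Fintype G] [Group H] [Fintype H]
    {t : Fin 4 → G} {s : Fin 4 → H} (hts : Pebble r t s) :
    Q G (t 0) (t 1) (t 2) (t 3) ↔ Q H (s 0) (s 1) (s 2) (s 3) :=
  ⟨h G H t s hts, h H G s t hts.symm⟩

theorem mono {r' : ℕ} (hr : r ≤ r') (h : WLInvariant r Q) : WLInvariant r' Q :=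
  fun G H _ _ _ _ t s hts => h G H t s (hts.mono hr)

theorem congr (h : WLInvariant r Q)
    (hQ : ∀ (G : Type u) [Group G] [Fintype G] (a b c d : G), Q G a b c d ↔ Q' G a b c d) :
    WLInvariant r Q' := fun G H _ _ _ _ t s hts hq => (hQ ..).1 (h G H t s hts ((hQ ..).2 hq))

theorem not (h : WLInvariant r Q) : WLInvariant r fun G _ _ a b c d => ¬ Q G a b c d :=
  fun _ _ _ _ _ _ _ _ hts => mt (h.iff hts).2

theorem and (h : WLInvariant r Q) (h' : WLInvariant r Q') : WLInvariant r fun G _ _ a b c d => Q G a b c d ∧ Q' G a b c d :=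
  fun _ _ _ _ _ _ _ _ hts => And.imp (h.iff hts).1 (h'.iff hts).1

theorem or (h : WLInvariant r Q) (h' : WLInvariant r Q') : WLInvariant r fun G _ _ a b c d => Q G a b c d ∨ Q' G a b c d :=
  fun _ _ _ _ _ _ _ _ hts => Or.imp (h.iff hts).1 (h'.iff hts).1

theorem imp (h : WLInvariant r Q) (h' : WLInvariant r Q') : WLInvariant r fun G _ _ a b c d => Q G a b c d → Q' G a b c d :=
  fun _ _ _ _ _ _ _ _ hts hq hq' => (h'.iff hts).1 (hq ((h.iff hts).2 hq'))

/-- Conjunctions of any size cost no round, since invariance is a semantic condition. Formulas may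
therefore run over all neighbours of a vertex or, dually, over all exponents up to `p`. -/
theorem forall_index {ι : Sort*} {R : ι → GroupPred.{u}} (h : ∀ i, WLInvariant r (R i)) :
    WLInvariant r fun G _ _ a b c d => ∀ i, R i G a b c d :=
  fun _ _ _ _ _ _ _ _ hts hq i => ((h i).iff hts).1 (hq i)

theorem exists_index {ι : Sort*} {R : ι → GroupPred.{u}} (h : ∀ i, WLInvariant r (R i)) :
    WLInvariant r fun G _ _ a b c d => ∃ i, R i G a b c d :=
  fun _ _ _ _ _ _ _ _ hts => Exists.imp fun i => ((h i).iff hts).1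

theorem perm (h : WLInvariant r Q) (π : Fin 4 → Fin 4) : WLInvariant r fun G _ _ a b c d =>
    Q G (![a, b, c, d] (π 0)) (![a, b, c, d] (π 1)) (![a, b, c, d] (π 2)) (![a, b, c, d] (π 3)) := by
  intro G H _ _ _ _ t s hts hq
  rw [vec_four_eta] at hq ⊢
  exact h G H _ _ (hts.comp π) hq

theorem ex (h : WLInvariant r Q) : WLInvariant (r + 1) fun G _ _ a b c _ => ∃ x, Q G a b c x := by
  rintro G H _ _ _ _ t s hts ⟨x, hx⟩
  obtain ⟨σ, hσ⟩ := hts.exists_equiv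
  exact ⟨σ x, h G H _ _ (hσ x) hx⟩

theorem all (h : WLInvariant r Q) : WLInvariant (r + 1) fun G _ _ a b c _ => ∀ x, Q G a b c x :=
  h.not.ex.not.congr fun G _ _ a b c _ => by simp

theorem card (h : WLInvariant r Q) (P : ℕ → Prop) :
    WLInvariant (r + 1) fun G _ _ a b c _ => P (Nat.card {x // Q G a b c x}) := by
  rintro G H _ _ _ _ t s hts hx
  obtain ⟨σ, hσ⟩ := hts.exists_equiv
  have : Nat.card {x // Q G (t 0) (t 1) (t 2) x} = Nat.card {x // Q H (s 0) (s 1) (s 2) x} :=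
    Nat.card_congr (σ.subtypeEquiv fun x => h.iff (hσ x))
  rwa [this] at hx

theorem mul (i j l : Fin 4) : WLInvariant 0 fun G _ _ a b c d =>
    (![a, b, c, d] i : G) * ![a, b, c, d] j = ![a, b, c, d] l := by
  intro G H _ _ _ _ t s hts hq
  rw [vec_four_eta] at hq ⊢
  exact (hts.mul_iff i j l).1 hq

theorem eq (i j : Fin 4) : WLInvariant 0 fun G _ _ a b c d =>
    (![a, b, c, d] i : G) = ![a, b, c, d] j := by
  intro G H _ _ _ _ t s hts hq
  rw [vec_four_eta] at hq ⊢
  exact (hts.eq_iff i j).1 hq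

theorem eq_one : WLInvariant.{u} 0 fun _ _ _ a _ _ _ => a = 1 :=
  (mul 0 0 0).congr fun G _ _ a b c d => by simp

theorem commute : WLInvariant.{u} 1 fun _ _ _ a b _ _ => Commute a b :=
  ((mul 0 1 3).and (mul 1 0 3)).ex.congr fun G _ _ a b c d => by
    simp [Commute, SemiconjBy, eq_comm]

theorem central : WLInvariant.{u} 2 fun G _ _ a _ _ _ => a ∈ Subgroup.center G :=
  (commute.perm ![0, 3, 2, 1]).all.congr fun G _ _ a b c d => by
    rw [Subgroup.mem_center_iff]
    exact forall_congr' fun x => eq_comm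

/-- The equation says `z * b * a = a * b`. Once `w = z * b` is on the board, `z` is no longer
needed, and its slot holds the common value of `w * a` and `a * b`. -/
theorem commutator_eq : WLInvariant.{u} 2 fun _ _ _ z a b _ => z = ⁅a, b⁆ := by
  have h : WLInvariant.{u} 1 fun G _ _ _ a b w => w * a = a * b :=
    ((mul 0 1 3).and (mul 1 2 3)).ex.perm ![3, 1, 2, 0] |>.congr fun G _ _ a b c d => by
      simp [eq_comm]
  refine (((mul 0 2 3).mono (Nat.zero_le 1)).and h).ex.congr fun G _ _ z a b d => ?_
  simp only [Matrix.cons_val]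
  constructor
  · rintro ⟨w, rfl, hw⟩
    rw [commutatorElement_def, ← hw]
    group
  · rintro rfl
    exact ⟨_, rfl, by rw [commutatorElement_def]; group⟩

/-- Products of at most `j ≤ 2 ^ k` elements satisfying a predicate are recognised in `2 * k` further
rounds. -/
theorem pow {A : ∀ (G : Type u) [Group G] [Fintype G], G → G → Prop}
    (h : WLInvariant r fun G _ _ c a _ _ => A G c a) (k j : ℕ) (hj : j ≤ 2 ^ k) :
    WLInvariant (r + 2 * k) fun G _ _ c a _ _ => a ∈ (insert 1 {x | A G c x} : Set G) ^ j := by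
  induction k generalizing j with
  | zero =>
    have hj : j = 0 ∨ j = 1 := by simp at hj; omega
    rcases hj with rfl | rfl
    · exact ((eq_one.perm ![1, 0, 2, 3]).mono (Nat.zero_le _)).congr fun G _ _ c a _ _ => by simp
    · exact (((eq_one.perm ![1, 0, 2, 3]).mono (Nat.zero_le _)).or h).congr
        fun G _ _ c a _ _ => by simp
  | succ k ih =>
    have hj2 : j / 2 ≤ 2 ^ k := by rw [pow_succ] at hj; omega
    have hj3 : j - j / 2 ≤ 2 ^ k := by rw [pow_succ] at hj; omega
    -- The two factors occupy slots 2 and 3, while `c` and `a` stay in slots 0 and 1. Two elements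
    -- are placed per halving, which gives the two rounds.
    refine (((((ih _ hj2).perm ![0, 3, 1, 2]).and ((ih _ hj3).perm ![0, 2, 1, 3])).and
      ((mul 3 2 1).mono (Nat.zero_le _))).ex.perm ![0, 1, 3, 2]).ex.congr fun G _ _ c a _ _ => ?_
    conv_rhs => rw [← Nat.add_sub_of_le (Nat.div_le_self j 2), pow_add, Set.mem_mul]
    simp only [Matrix.cons_val]
    constructor
    · rintro ⟨y, x, ⟨hx, hy⟩, hxy⟩
      exact ⟨x, hx, y, hy, hxy⟩
    · rintro ⟨x, hx, y, hy, hxy⟩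
      exact ⟨y, x, ⟨hx, hy⟩, hxy⟩

/-- Powers with exponent at most `2 ^ 2 ^ k` are recognised in `3 * k` rounds. -/
theorem eq_pow (k i : ℕ) (hi : i ≤ 2 ^ 2 ^ k) :
    WLInvariant.{u} (3 * k) fun _ _ _ x y _ _ => y = x ^ i := by
  induction k generalizing i with
  | zero =>
    have hi : i = 0 ∨ i = 1 ∨ i = 2 := by simp at hi; omega
    rcases hi with rfl | rfl | rfl
    · exact (eq_one.perm ![1, 0, 2, 3]).congr fun G _ _ x y _ _ => by simp
    · exact (eq 1 0).congr fun G _ _ x y _ _ => by simp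
    · exact (mul 0 0 1).congr fun G _ _ x y _ _ => by simp [_root_.pow_two, eq_comm]
  | succ k ih =>
    -- As `i ≤ B ^ 2`, both `i / B` and `i % B` are at most `B`. The auxiliary elements `x ^ B`, `(x
    -- ^ B) ^ (i / B)` and `x ^ (i % B)` cost three rounds; the last one takes the slot of the
    -- first.
    set B := 2 ^ 2 ^ k with hB
    have hBpos : 0 < B := by positivity
    have ha : i / B ≤ B := by
      refine Nat.div_le_of_le_mul ?_
      rw [_root_.pow_succ, _root_.pow_mul, _root_.pow_two] at hi
      exact hi
    have hb : i % B ≤ B := (Nat.mod_lt _ hBpos).le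
    have h1 : WLInvariant.{u} (3 * k + 1) fun G _ _ x y v _ => v * x ^ (i % B) = y :=
      (((ih _ hb).perm ![0, 3, 1, 2]).and ((mul 2 3 1).mono (Nat.zero_le _))).ex.congr
        fun G _ _ x y v _ => by simp
    have h2 : WLInvariant.{u} (3 * k + 2) fun G _ _ x y u _ => u ^ (i / B) * x ^ (i % B) = y :=
      ((((ih _ ha).perm ![2, 3, 0, 1]).mono (Nat.le_succ _)).and (h1.perm ![0, 1, 3, 2])).ex.congr
        fun G _ _ x y u _ => by simp
    refine ((((ih B le_rfl).perm ![0, 3, 1, 2]).mono (by omega)).and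
      (h2.perm ![0, 1, 3, 2])).ex.congr fun G _ _ x y _ _ => ?_
    simp only [Matrix.cons_val, exists_eq_left, ← _root_.pow_mul, ← _root_.pow_add,
      Nat.div_add_mod]
    exact eq_comm

theorem pow_eq_one (k i : ℕ) (hi : i ≤ 2 ^ 2 ^ k) :
    WLInvariant.{u} (3 * k + 1) fun _ _ _ x _ _ _ => x ^ i = 1 :=
  (((eq_pow k i hi).perm ![0, 3, 1, 2]).and
    ((eq_one.perm ![3, 0, 1, 2]).mono (Nat.zero_le _))).ex.congr fun G _ _ x _ _ _ => by simp

end WLInvariant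

/-! ### A model of Mekler's groups -/

/-- The pairs of distinct non-adjacent vertices. -/
abbrev NonEdge {X : Type*} [LinearOrder X] (Γ : SimpleGraph X) : Type _ :=
  {e : X × X // e.1 < e.2 ∧ ¬ Γ.Adj e.1 e.2}

/-- The class `2` group of pairs of a vector indexed by the vertices and a vector indexed by the
non-edges, in which the second vectors are central and the commutator of the first ones is given by
the minors belonging to the non-edges. -/
@[ext]
structure MeklerModel {X : Type*} [LinearOrder X] (p : ℕ) (Γ : SimpleGraph X) where
  vec : X → ZMod p
  cen : NonEdge Γ → ZMod p

namespace MeklerModel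

variable {X : Type*} [LinearOrder X] {p : ℕ} {Γ : SimpleGraph X}

instance : Mul (MeklerModel p Γ) :=
  ⟨fun g h => ⟨g.vec + h.vec, fun e => g.cen e + h.cen e + g.vec e.1.1 * h.vec e.1.2⟩⟩

instance : One (MeklerModel p Γ) := ⟨⟨0, 0⟩⟩

instance : Inv (MeklerModel p Γ) :=
  ⟨fun g => ⟨-g.vec, fun e => -g.cen e + g.vec e.1.1 * g.vec e.1.2⟩⟩

@[simp] theorem vec_mul (g h : MeklerModel p Γ) : (g * h).vec = g.vec + h.vec := rfl

@[simp] theorem cen_mul (g h : MeklerModel p Γ) (e : NonEdge Γ) :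
    (g * h).cen e = g.cen e + h.cen e + g.vec e.1.1 * h.vec e.1.2 := rfl

@[simp] theorem vec_one : (1 : MeklerModel p Γ).vec = 0 := rfl

@[simp] theorem cen_one : (1 : MeklerModel p Γ).cen = 0 := rfl

@[simp] theorem vec_inv (g : MeklerModel p Γ) : g⁻¹.vec = -g.vec := rfl

@[simp] theorem cen_inv (g : MeklerModel p Γ) (e : NonEdge Γ) :
    g⁻¹.cen e = -g.cen e + g.vec e.1.1 * g.vec e.1.2 := rfl

instance : Group (MeklerModel p Γ) :=
  Group.ofLeftAxioms
    (fun g h k => by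
      ext
      · simp [add_assoc]
      · simp; ring)
    (fun g => by ext <;> simp)
    (fun g => by ext <;> simp)

/-- The underlying pair of vectors. -/
def equivProd : MeklerModel p Γ ≃ (X → ZMod p) × (NonEdge Γ → ZMod p) where
  toFun g := (g.vec, g.cen)
  invFun g := ⟨g.1, g.2⟩

noncomputable instance [Finite X] [NeZero p] : Fintype (MeklerModel p Γ) :=
  haveI := Fintype.ofFinite X
  haveI := Fintype.ofFinite (NonEdge Γ)
  haveI := ZMod.fintype p
  Fintype.ofEquiv _ equivProd.symm

theorem commute_iff {g h : MeklerModel p Γ} :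
    Commute g h ↔ ∀ u v, ¬ Γ.Adj u v → g.vec u * h.vec v = h.vec u * g.vec v := by
  rw [Commute, SemiconjBy, MeklerModel.ext_iff]
  constructor
  · rintro ⟨-, h2⟩ u v huv
    have key : ∀ e : NonEdge Γ, g.vec e.1.1 * h.vec e.1.2 = h.vec e.1.1 * g.vec e.1.2 := fun e => by
      have := congrFun h2 e
      simp only [cen_mul] at this
      linear_combination this
    rcases lt_trichotomy u v with hlt | rfl | hlt
    · exact key ⟨(u, v), hlt, huv⟩
    · ring
    · have := key ⟨(v, u), hlt, fun h => huv h.symm⟩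
      simp only at this
      linear_combination -this
  · intro hc
    refine ⟨add_comm _ _, funext fun e => ?_⟩
    simp only [cen_mul]
    linear_combination hc e.1.1 e.1.2 e.2.2

theorem commutator_eq (g h : MeklerModel p Γ) :
    ⁅g, h⁆ = ⟨0, fun e => g.vec e.1.1 * h.vec e.1.2 - h.vec e.1.1 * g.vec e.1.2⟩ := by
  rw [commutatorElement_def, mul_inv_eq_iff_eq_mul, mul_inv_eq_iff_eq_mul]
  ext
  · simp [add_comm]
  · simp; ring

theorem mem_center_of_vec_eq_zero {g : MeklerModel p Γ} (hg : g.vec = 0) :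
    g ∈ Subgroup.center (MeklerModel p Γ) := by
  rw [Subgroup.mem_center_iff]
  intro h
  exact (commute_iff.2 fun u v _ => by simp [hg] : Commute h g)

/-- The elements of the form `x_v ^ d`. -/
def gen (v : X) (d : ZMod p) : MeklerModel p Γ := ⟨Pi.single v d, 0⟩

@[simp] theorem vec_gen (v : X) (d : ZMod p) : (gen v d : MeklerModel p Γ).vec = Pi.single v d := rfl

@[simp] theorem cen_gen (v : X) (d : ZMod p) : (gen v d : MeklerModel p Γ).cen = 0 := rfl

theorem single_mul_single_of_nonEdge (e : NonEdge Γ) (v : X) (d d' : ZMod p) :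
    (Pi.single v d : X → ZMod p) e.1.1 * (Pi.single v d' : X → ZMod p) e.1.2 = 0 := by
  by_cases h : e.1.1 = v
  · have : e.1.2 ≠ v := fun h' => e.2.1.ne (h.trans h'.symm)
    simp [Pi.single_eq_of_ne this]
  · simp [Pi.single_eq_of_ne h]

theorem gen_mul_gen (v : X) (d d' : ZMod p) :
    (gen v d * gen v d' : MeklerModel p Γ) = gen v (d + d') := by
  ext x
  · simp [Pi.single_add]
  · simp [single_mul_single_of_nonEdge]

theorem gen_zero (v : X) : (gen v 0 : MeklerModel p Γ) = 1 := by
  ext <;> simp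

theorem gen_pow (v : X) (d : ZMod p) (k : ℕ) : (gen v d : MeklerModel p Γ) ^ k = gen v ((k : ZMod p) * d) := by
  induction k with
  | zero => simp [gen_zero]
  | succ k ih => rw [pow_succ, ih, gen_mul_gen]; congr 1; push_cast; ring

/-- The embedding of the vectors indexed by the non-edges. -/
def emb : Multiplicative (NonEdge Γ → ZMod p) →* MeklerModel p Γ where
  toFun z := ⟨0, z.toAdd⟩
  map_one' := rfl
  map_mul' z z' := by ext <;> simp

@[simp] theorem vec_emb (z : Multiplicative (NonEdge Γ → ZMod p)) : (emb z : MeklerModel p Γ).vec = 0 :=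
  rfl

@[simp] theorem cen_emb (z : Multiplicative (NonEdge Γ → ZMod p)) :
    (emb z : MeklerModel p Γ).cen = z.toAdd := rfl

/-- The projection to the vectors indexed by the vertices. -/
def vecHom : MeklerModel p Γ →* Multiplicative (X → ZMod p) where
  toFun g := Multiplicative.ofAdd g.vec
  map_one' := rfl
  map_mul' _ _ := rfl

theorem commutator_gen_gen (e : NonEdge Γ) (d d' : ZMod p) :
    ⁅(gen e.1.1 d : MeklerModel p Γ), gen e.1.2 d'⁆ =
      emb (Multiplicative.ofAdd (Pi.single e (d * d'))) := by
  rw [commutator_eq]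
  ext f
  · rfl
  · simp only [vec_gen, cen_emb, toAdd_ofAdd]
    by_cases hf : f = e
    · subst hf
      simp [Pi.single_eq_of_ne f.2.1.ne, Pi.single_eq_of_ne f.2.1.ne']
    · rw [Pi.single_eq_of_ne hf]
      by_cases h1 : f.1.1 = e.1.1
      · have h2 : f.1.2 ≠ e.1.2 := fun h2 => hf (Subtype.ext (Prod.ext h1 h2))
        have h3 : f.1.1 ≠ e.1.2 := fun h3 => e.2.1.ne (h1.symm.trans h3)
        simp [Pi.single_eq_of_ne h2, Pi.single_eq_of_ne h3]
      · by_cases h2 : f.1.1 = e.1.2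
        · have h3 : f.1.2 ≠ e.1.1 := fun h3 => by
            have := f.2.1
            rw [h2, h3] at this
            exact this.not_gt e.2.1
          simp [Pi.single_eq_of_ne h1, Pi.single_eq_of_ne h3]
        · simp [Pi.single_eq_of_ne h1, Pi.single_eq_of_ne h2]

/-- Each factor clears one coordinate, so the support bounds the word length; length is how central
elements are measured below. -/
theorem emb_mem_pow {S : Set (MeklerModel p Γ)}
    (hS : ∀ e d, emb (Multiplicative.ofAdd (Pi.single e d)) ∈ S) (s : Finset (NonEdge Γ))
    (z : NonEdge Γ → ZMod p) (hz : ∀ e ∉ s, z e = 0) :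
    emb (Multiplicative.ofAdd z) ∈ S ^ s.card := by
  induction s using Finset.induction_on generalizing z with
  | empty =>
    have : z = 0 := funext fun e => hz e (Finset.notMem_empty e)
    simp [this]
  | insert f s hf ih =>
    have h : z = Pi.single f (z f) + Function.update z f 0 := by
      funext e
      by_cases he : e = f
      · subst he; simp
      · simp [Pi.single_eq_of_ne he, Function.update_of_ne he]
    rw [Finset.card_insert_of_notMem hf, pow_succ', h, ofAdd_add, map_mul]
    refine Set.mul_mem_mul (hS _ _) (ih _ fun e he => ?_)
    by_cases hef : e = f
    · subst hef; simp
    · rw [Function.update_of_ne hef]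
      exact hz e (by simp [hef, he])

/-- Dividing by a generator power clears one vertex coordinate. The `+ 1` is the remaining factor,
whose vertex part vanishes. -/
theorem mem_pow_of_vec {S : Set (MeklerModel p Γ)} (hS : ∀ v d, gen v d ∈ S)
    (hS' : ∀ g : MeklerModel p Γ, g.vec = 0 → g ∈ S) (s : Finset X)
    (g : MeklerModel p Γ) (hg : ∀ v ∉ s, g.vec v = 0) : g ∈ S ^ (s.card + 1) := by
  induction s using Finset.induction_on generalizing g with
  | empty =>
    rw [Finset.card_empty, zero_add, pow_one]
    exact hS' g (funext fun e => hg e (Finset.notMem_empty e))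
  | insert f s hf ih =>
    have h : g = gen f (g.vec f) * ((gen f (g.vec f))⁻¹ * g) := by group
    rw [Finset.card_insert_of_notMem hf, pow_succ', h]
    refine Set.mul_mem_mul (hS _ _) (ih _ fun e he => ?_)
    by_cases hef : e = f
    · subst hef; simp
    · simp [Pi.single_eq_of_ne hef, hg e (by simp [hef, he])]

theorem eq_top_of_gen_mem [Fintype X] {K : Subgroup (MeklerModel p Γ)} (hK : ∀ v d, gen v d ∈ K) : K = ⊤ := by
  classical
  have hpow : ∀ n : ℕ, ((K : Set (MeklerModel p Γ)) ^ n) ⊆ K := by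
    intro n
    induction n with
    | zero => simp [K.one_mem]
    | succ n ih =>
      rw [pow_succ]
      rintro _ ⟨a, ha, b, hb, rfl⟩
      exact K.mul_mem (ih ha) hb
  have hemb : ∀ z, emb z ∈ K := fun z => by
    refine hpow _ (emb_mem_pow (S := K) (fun e d => ?_) Finset.univ z.toAdd (by simp))
    have := commutator_gen_gen e d 1
    rw [mul_one] at this
    rw [← this, commutatorElement_def]
    exact K.mul_mem (K.mul_mem (K.mul_mem (hK _ _) (hK _ _)) (K.inv_mem (hK _ _)))
      (K.inv_mem (hK _ _))
  refine (Subgroup.eq_top_iff' K).2 fun g => hpow _ (mem_pow_of_vec (S := K) hK (fun g hg => ?_)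
    Finset.univ g (by simp))
  have : g = emb (Multiplicative.ofAdd g.cen) := by ext <;> simp [hg]
  rw [this]
  exact hemb _

end MeklerModel

/-! ### Mekler's groups and the model -/

section Mekler

open scoped IsMulCommutative

variable {X : Type*} {p : ℕ} {Γ : SimpleGraph X}

theorem meklerGroup_of_pow (v : X) : (PresentedGroup.of v : MeklerGroup p Γ) ^ p = 1 := by
  have h : PresentedGroup.mk (meklerRels p Γ) (FreeGroup.of v ^ p) = 1 :=
    PresentedGroup.one_of_mem (Or.inl (Or.inl ⟨v, rfl⟩))
  rwa [map_pow] at h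

theorem meklerGroup_commutator_eq_one {u v : X} (h : Γ.Adj u v) :
    ⁅(PresentedGroup.of u : MeklerGroup p Γ), (PresentedGroup.of v : MeklerGroup p Γ)⁆ = 1 := by
  have h : PresentedGroup.mk (meklerRels p Γ) ⁅FreeGroup.of u, FreeGroup.of v⁆ = 1 :=
    PresentedGroup.one_of_mem (Or.inr ⟨u, v, h, rfl⟩)
  rwa [map_commutatorElement] at h

theorem meklerGroup_commutator_mem_center (u v : X) :
    ⁅(PresentedGroup.of u : MeklerGroup p Γ), (PresentedGroup.of v : MeklerGroup p Γ)⁆ ∈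
      Subgroup.center (MeklerGroup p Γ) := by
  rw [Subgroup.mem_center_iff]
  intro g
  have : Subgroup.closure (Set.range (PresentedGroup.of (rels := meklerRels p Γ))) ≤
      Subgroup.centralizer {⁅(PresentedGroup.of u : MeklerGroup p Γ),
        (PresentedGroup.of v : MeklerGroup p Γ)⁆} := by
    rw [Subgroup.closure_le]
    rintro _ ⟨l, rfl⟩
    refine Subgroup.mem_centralizer_singleton_iff.2 ?_
    have h : PresentedGroup.mk (meklerRels p Γ)
        ⁅⁅FreeGroup.of u, FreeGroup.of v⁆, FreeGroup.of l⁆ = 1 :=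
      PresentedGroup.one_of_mem (Or.inl (Or.inr ⟨u, v, l, rfl⟩))
    rw [map_commutatorElement, map_commutatorElement, commutatorElement_eq_one_iff_mul_comm] at h
    exact h.symm
  rw [PresentedGroup.closure_range_of] at this
  exact Subgroup.mem_centralizer_singleton_iff.1 (this (Subgroup.mem_top g))

/-- Every passage of `x` across `y` leaves one central commutator behind. For generators this shows
that their commutators have order dividing `p`. -/
theorem commutator_pow_of_mem_center {G : Type*} [Group G] {x y : G}
    (h : ⁅x, y⁆ ∈ Subgroup.center G) (n : ℕ) : ⁅x, y⁆ ^ n = ⁅x ^ n, y⁆ := by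
  have key : x ^ n * y = ⁅x, y⁆ ^ n * (y * x ^ n) := by
    induction n with
    | zero => simp
    | succ n ih =>
      have hc : x * ⁅x, y⁆ ^ n = ⁅x, y⁆ ^ n * x :=
        Subgroup.mem_center_iff.1 (Subgroup.pow_mem _ h n) x
      have hxy : x * y = ⁅x, y⁆ * y * x := by rw [commutatorElement_def]; group
      rw [pow_succ' x, mul_assoc, ih, ← mul_assoc x, hc, mul_assoc _ x, ← mul_assoc x, hxy,
        pow_succ ⁅x, y⁆]
      simp only [mul_assoc]
  rw [commutatorElement_def (x ^ n), key]
  group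

variable [LinearOrder X]

open MeklerModel

/-- The homomorphism of Mekler's group to the model. -/
def meklerToModel (p : ℕ) (Γ : SimpleGraph X) : MeklerGroup p Γ →* MeklerModel p Γ :=
  PresentedGroup.toGroup (f := fun v => gen v 1) (by
    rintro _ ((⟨i, rfl⟩ | ⟨i, j, l, rfl⟩) | ⟨i, j, hij, rfl⟩)
    · simp [gen_pow, gen_zero]
    · simp only [map_commutatorElement, FreeGroup.lift_apply_of]
      rw [commutatorElement_eq_one_iff_commute]
      refine (Subgroup.mem_center_iff.1 (mem_center_of_vec_eq_zero ?_) _).symm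
      rw [MeklerModel.commutator_eq]
    · simp only [map_commutatorElement, FreeGroup.lift_apply_of]
      rw [commutatorElement_eq_one_iff_commute, commute_iff]
      intro u v huv
      simp only [vec_gen]
      by_cases hu : u = i
      · by_cases hv : v = j
        · subst hu hv; exact absurd hij huv
        · by_cases hu' : u = j
          · exact absurd (hu.symm.trans hu') hij.ne
          · simp [Pi.single_eq_of_ne hv, Pi.single_eq_of_ne hu']
      · by_cases hv : v = i
        · by_cases hu' : u = j
          · subst hu' hv; exact absurd hij.symm huv
          · simp [Pi.single_eq_of_ne hu, Pi.single_eq_of_ne hu']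
        · simp [Pi.single_eq_of_ne hu, Pi.single_eq_of_ne hv])

@[simp] theorem meklerToModel_of (v : X) :
    meklerToModel p Γ (PresentedGroup.of v) = gen v 1 := PresentedGroup.toGroup.of _

theorem meklerToModel_surjective [Fintype X] [NeZero p] :
    Function.Surjective (meklerToModel p Γ) := by
  rw [← MonoidHom.range_eq_top]
  refine eq_top_of_gen_mem fun v d => ⟨PresentedGroup.of v ^ d.val, ?_⟩
  rw [map_pow, meklerToModel_of, gen_pow]
  simp

/-- The commutators of pairs of generators as central elements. -/
def meklerCentral (p : ℕ) (Γ : SimpleGraph X) (e : NonEdge Γ) : Subgroup.center (MeklerGroup p Γ) :=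
  ⟨⁅PresentedGroup.of e.1.1, PresentedGroup.of e.1.2⁆, meklerGroup_commutator_mem_center _ _⟩

/-- Modulo the central subgroup generated by the non-edge commutators the generators commute, so the
image of `g` is a product of their powers. The discrepancy lies in that subgroup, which is abelian.
-/
theorem meklerGroup_normal_form [Fintype X] [Fintype (NonEdge Γ)] (g : MeklerGroup p Γ) :
    ∃ (w : X → ℤ) (k : NonEdge Γ → ℤ),
      g = ((Finset.univ : Finset X).toList.map fun v => (PresentedGroup.of v : MeklerGroup p Γ) ^ w v).prod *
        (∏ e, meklerCentral p Γ e ^ k e : Subgroup.center (MeklerGroup p Γ)).1 := by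
  let Z : Subgroup (MeklerGroup p Γ) :=
    (Subgroup.closure (Set.range (meklerCentral p Γ))).map (Subgroup.center _).subtype
  have hZc : Z ≤ Subgroup.center _ := by
    rintro _ ⟨z, -, rfl⟩
    exact z.2
  have hZmem : ∀ e, (meklerCentral p Γ e : MeklerGroup p Γ) ∈ Z := fun e =>
    ⟨_, Subgroup.subset_closure ⟨e, rfl⟩, rfl⟩
  have hZ : Z.Normal := ⟨fun z hz g => by
    have : g * z * g⁻¹ = z := by rw [Subgroup.mem_center_iff.1 (hZc hz) g]; group
    rwa [this]⟩
  have hgen : ∀ u v : X, ⁅(PresentedGroup.of u : MeklerGroup p Γ), PresentedGroup.of v⁆ ∈ Z := by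
    intro u v
    by_cases huv : Γ.Adj u v
    · rw [meklerGroup_commutator_eq_one huv]; exact Z.one_mem
    · rcases lt_trichotomy u v with h | rfl | h
      · exact hZmem ⟨(u, v), h, huv⟩
      · rw [commutatorElement_self]; exact Z.one_mem
      · rw [← commutatorElement_inv]
        exact Z.inv_mem (hZmem ⟨(v, u), h, fun h => huv h.symm⟩)
  let f : X → MeklerGroup p Γ ⧸ Z := fun v => QuotientGroup.mk' Z (PresentedGroup.of v)
  have hcl : Subgroup.closure (Set.range f) = ⊤ := by
    have : Set.range f = QuotientGroup.mk' Z '' Set.range PresentedGroup.of := by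
      rw [← Set.range_comp]; rfl
    rw [this, ← MonoidHom.map_closure, PresentedGroup.closure_range_of,
      Subgroup.map_top_of_surjective _ (QuotientGroup.mk'_surjective Z)]
  have hcomm : ∀ x ∈ Set.range f, ∀ y ∈ Set.range f, x * y = y * x := by
    rintro _ ⟨u, rfl⟩ _ ⟨v, rfl⟩
    rw [← commutatorElement_eq_one_iff_mul_comm, ← map_commutatorElement]
    exact (QuotientGroup.eq_one_iff _).2 (hgen u v)
  have hQ : IsMulCommutative (MeklerGroup p Γ ⧸ Z) := isMulCommutative_iff.2 fun x y => by
    have h := (Subgroup.isMulCommutative_closure hcomm).is_comm.comm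
      ⟨x, hcl ▸ Subgroup.mem_top x⟩ ⟨y, hcl ▸ Subgroup.mem_top y⟩
    exact congrArg Subtype.val h
  obtain ⟨w, hw⟩ := Subgroup.exists_of_mem_closure_range f (QuotientGroup.mk' Z g)
    (hcl ▸ Subgroup.mem_top _)
  have hw' : QuotientGroup.mk' Z g = QuotientGroup.mk' Z
      ((Finset.univ : Finset X).toList.map fun v => (PresentedGroup.of v : MeklerGroup p Γ) ^ w v).prod := by
    rw [hw, map_list_prod, List.map_map, ← Finset.prod_map_toList]
    rfl
  obtain ⟨z, hz, hz'⟩ := (QuotientGroup.mk'_eq_mk' Z).1 hw'.symm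
  obtain ⟨z, hz, rfl⟩ := hz
  obtain ⟨k, rfl⟩ := Subgroup.exists_of_mem_closure_range _ z hz
  exact ⟨w, k, hz'.symm⟩

theorem zpow_eq_one_of_cast_eq_zero {G : Type*} [Group G] {x : G} (hx : x ^ p = 1) {k : ℤ}
    (hk : (k : ZMod p) = 0) : x ^ k = 1 := by
  obtain ⟨l, rfl⟩ := (ZMod.intCast_zmod_eq_zero_iff_dvd k p).1 hk
  rw [zpow_mul, zpow_natCast, hx, one_zpow]

/-- In the model the vertex coordinates read off the exponents `w` modulo `p`, and once those
factors are gone the central coordinates read off `k`. All generators in the normal form have order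
dividing `p`, so a trivial image makes every factor trivial. -/
theorem meklerToModel_injective [Fintype X] : Function.Injective (meklerToModel p Γ) := by
  classical
  rw [injective_iff_map_eq_one]
  intro g hg
  obtain ⟨w, k, rfl⟩ := meklerGroup_normal_form g
  set z : Subgroup.center (MeklerGroup p Γ) := ∏ e, meklerCentral p Γ e ^ k e with hz
  have hφz : meklerToModel p Γ z =
      emb (∏ e, Multiplicative.ofAdd (Pi.single e 1 : NonEdge Γ → ZMod p) ^ k e) := by
    change ((meklerToModel p Γ).comp (Subgroup.center _).subtype) z = _
    rw [hz, ← Finset.prod_map_toList, ← Finset.prod_map_toList, map_list_prod, map_list_prod,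
      List.map_map, List.map_map]
    congr 1
    refine List.map_congr_left fun e _ => ?_
    simp only [Function.comp, map_zpow]
    congr 1
    change meklerToModel p Γ ⁅(PresentedGroup.of e.1.1 : MeklerGroup p Γ), PresentedGroup.of e.1.2⁆ = _
    rw [map_commutatorElement, meklerToModel_of, meklerToModel_of, commutator_gen_gen, mul_one]
  have hw : ∀ v, (w v : ZMod p) = 0 := by
    intro v
    have h := congrArg (fun x => (vecHom x).toAdd v) hg
    rw [map_mul, hφz, map_list_prod, map_mul, map_list_prod, List.map_map, List.map_map,
      Finset.prod_map_toList] at h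
    simp only [Function.comp_def, map_zpow, meklerToModel_of] at h
    have h2 : vecHom (emb (∏ e, Multiplicative.ofAdd (Pi.single e 1 : NonEdge Γ → ZMod p) ^ k e)) =
      1 := rfl
    rw [h2, mul_one, toAdd_prod, Finset.sum_apply, Finset.sum_eq_single v] at h
    · simpa [vecHom] using h
    · intro u _ huv
      simp [vecHom, Pi.single_eq_of_ne' huv]
    · simp
  have hlist : ((Finset.univ : Finset X).toList.map fun v =>
      (PresentedGroup.of v : MeklerGroup p Γ) ^ w v).prod = 1 := by
    refine List.prod_eq_one fun x hx => ?_
    obtain ⟨v, -, rfl⟩ := List.mem_map.1 hx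
    exact zpow_eq_one_of_cast_eq_zero (meklerGroup_of_pow v) (hw v)
  rw [hlist, one_mul] at hg ⊢
  have hk : ∀ e, (k e : ZMod p) = 0 := by
    intro e
    have h := congrArg (fun x => x.cen e) (hφz.symm.trans hg)
    simp only [cen_emb, toAdd_prod, Finset.sum_apply, cen_one, Pi.zero_apply] at h
    rw [Finset.sum_eq_single e] at h
    · simpa using h
    · intro u _ huv
      simp [Pi.single_eq_of_ne' huv]
    · simp
  have : z = 1 := by
    refine Finset.prod_eq_one fun e _ => zpow_eq_one_of_cast_eq_zero (Subtype.ext ?_) (hk e)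
    change ⁅(PresentedGroup.of e.1.1 : MeklerGroup p Γ), PresentedGroup.of e.1.2⁆ ^ p = _
    rw [commutator_pow_of_mem_center (meklerGroup_commutator_mem_center _ _), meklerGroup_of_pow]
    simp
  rw [this]
  rfl

/-- Mekler's group is isomorphic to the model. -/
noncomputable def meklerEquivModel [Fintype X] [NeZero p] : MeklerGroup p Γ ≃* MeklerModel p Γ :=
  MulEquiv.ofBijective (meklerToModel p Γ) ⟨meklerToModel_injective, meklerToModel_surjective⟩

end Mekler

/-! ### Centralizers -/

/-- Graphs of minimal degree at least two without triangles and squares. -/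
structure SimpleGraph.IsNice {X : Type*} (Γ : SimpleGraph X) : Prop where
  no_triangle : ∀ {u v w : X}, Γ.Adj u v → Γ.Adj v w → ¬ Γ.Adj u w
  no_square : ∀ {u v a b : X}, u ≠ v → Γ.Adj u a → Γ.Adj v a → Γ.Adj u b → Γ.Adj v b → a = b
  two_neighbors : ∀ u : X, ∃ a b, a ≠ b ∧ Γ.Adj u a ∧ Γ.Adj u b

theorem SimpleGraph.IsNice.exists_not_adj {X : Type*} {Γ : SimpleGraph X} (hΓ : Γ.IsNice) (u : X) :
    ∃ v, v ≠ u ∧ ¬ Γ.Adj u v := by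
  obtain ⟨a, -, -, ha, -⟩ := hΓ.two_neighbors u
  obtain ⟨b, c, hbc, hb, hc⟩ := hΓ.two_neighbors a
  by_cases h : b = u
  · exact ⟨c, fun h' => hbc (h.trans h'.symm), hΓ.no_triangle ha hc⟩
  · exact ⟨b, h, hΓ.no_triangle ha hb⟩

/-- Non-central elements with more than `K` elements in their centralizer. -/
def IsVertexLike (K : ℕ) (G : Type*) [Group G] (g : G) : Prop :=
  g ∉ Subgroup.center G ∧ K < Nat.card {h : G // Commute g h}

theorem WLInvariant.isVertexLike (K : ℕ) :
    WLInvariant.{u} 2 fun G _ _ g _ _ _ => IsVertexLike K G g :=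
  central.not.and ((commute.perm ![0, 3, 1, 2]).card fun n => K < n)

theorem IsVertexLike.map {K : ℕ} {G H : Type*} [Group G] [Group H] (e : G ≃* H) {g : G}
    (h : IsVertexLike K G g) : IsVertexLike K H (e g) := by
  refine ⟨fun hc => h.1 (Subgroup.mem_center_iff.2 fun x => e.injective ?_), ?_⟩
  · rw [map_mul, map_mul]
    exact Subgroup.mem_center_iff.1 hc (e x)
  · rw [← Nat.card_congr (e.toEquiv.subtypeEquiv fun x => ?_)]
    · exact h.2
    · change Commute g x ↔ Commute (e g) (e x)
      rw [Commute, SemiconjBy, Commute, SemiconjBy, ← map_mul, ← map_mul, e.injective.eq_iff]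

namespace MeklerModel

variable {X : Type*} [LinearOrder X] {p : ℕ} {Γ : SimpleGraph X}

theorem mem_center_iff [Fact p.Prime] (hΓ : Γ.IsNice) {g : MeklerModel p Γ} :
    g ∈ Subgroup.center (MeklerModel p Γ) ↔ g.vec = 0 := by
  refine ⟨fun h => funext fun u => ?_, mem_center_of_vec_eq_zero⟩
  obtain ⟨v, hvu, huv⟩ := hΓ.exists_not_adj u
  have h1 : Commute g (gen v 1) := (Subgroup.mem_center_iff.1 h (gen v 1)).symm
  simpa [Pi.single_eq_of_ne' hvu] using commute_iff.1 h1 u v huv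

/-- The vectors that commute with `w`. -/
abbrev VecCommute {Y : Type*} (Γ : SimpleGraph Y) (w w' : Y → ZMod p) : Prop :=
  ∀ u v, ¬ Γ.Adj u v → w u * w' v = w' u * w v

theorem card_commute (g : MeklerModel p Γ) :
    Nat.card {h : MeklerModel p Γ // Commute g h} =
      Nat.card {w // VecCommute Γ g.vec w} * Nat.card (NonEdge Γ → ZMod p) := by
  rw [← Nat.card_prod]
  refine Nat.card_congr
    { toFun := fun h => (⟨h.1.vec, commute_iff.1 h.2⟩, h.1.cen)
      invFun := fun h => ⟨⟨h.1.1, h.2⟩, commute_iff.2 h.1.2⟩ }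

theorem card_center [Fact p.Prime] (hΓ : Γ.IsNice) :
    Nat.card (Subgroup.center (MeklerModel p Γ)) = Nat.card (NonEdge Γ → ZMod p) :=
  Nat.card_congr
    { toFun := fun h => h.1.cen
      invFun := fun z => ⟨⟨0, z⟩, mem_center_of_vec_eq_zero rfl⟩
      left_inv := fun h => Subtype.ext
        (MeklerModel.ext ((mem_center_iff hΓ).1 h.2).symm rfl) }

/-- If `w c ≠ 0`, a commuting vector that vanishes at `c` vanishes at all non-neighbours of `c`.
With two such vertices only their common neighbours escape: there are none if the two are adjacent
(no triangles) and at most one otherwise (no squares). So two coordinates determine the vector. -/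
theorem card_vecCommute_le {Y : Type*} [Finite Y] {Γ : SimpleGraph Y} [Fact p.Prime] (hΓ : Γ.IsNice)
    {w : Y → ZMod p} {a b : Y}
    (hab : a ≠ b) (ha : w a ≠ 0) (hb : w b ≠ 0) : Nat.card {w' // VecCommute Γ w w'} ≤ p ^ 2 := by
  have hinj : ∃ c d : Y, ∀ w', VecCommute Γ w w' → w' c = 0 → w' d = 0 → w' = 0 := by
    have hzero : ∀ c, w c ≠ 0 → ∀ w', VecCommute Γ w w' → w' c = 0 → ∀ u, ¬ Γ.Adj c u → w' u = 0 := by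
      intro c hc w' hw' hwc u hcu
      have := hw' c u hcu
      rw [hwc, zero_mul] at this
      exact (mul_eq_zero.1 this).resolve_left hc
    have hnon : ∀ c d, c ≠ d → w c ≠ 0 → w d ≠ 0 → ¬ Γ.Adj c d →
        ∃ c d : Y, ∀ w', VecCommute Γ w w' → w' c = 0 → w' d = 0 → w' = 0 := by
      intro c d hcd hc hd hadj
      by_cases hy : ∃ y, Γ.Adj c y ∧ Γ.Adj d y
      · obtain ⟨y, hcy, hdy⟩ := hy
        refine ⟨c, y, fun w' hw' h1 h2 => funext fun u => ?_⟩
        have h3 := hzero c hc w' hw' h1 d hadj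
        by_cases hu : Γ.Adj c u
        · by_cases hu' : Γ.Adj d u
          · rw [hΓ.no_square hcd hu hu' hcy hdy, h2]; rfl
          · exact hzero d hd w' hw' h3 u hu'
        · exact hzero c hc w' hw' h1 u hu
      · push Not at hy
        refine ⟨c, c, fun w' hw' h1 _ => funext fun u => ?_⟩
        have h3 := hzero c hc w' hw' h1 d hadj
        by_cases hu : Γ.Adj c u
        · exact hzero d hd w' hw' h3 u (hy u hu)
        · exact hzero c hc w' hw' h1 u hu
    by_cases hadj : Γ.Adj a b
    · refine ⟨a, b, fun w' hw' h1 h2 => funext fun u => ?_⟩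
      by_cases hu : Γ.Adj a u
      · exact hzero b hb w' hw' h2 u (hΓ.no_triangle hadj.symm hu)
      · exact hzero a ha w' hw' h1 u hu
    · exact hnon a b hab ha hb hadj
  obtain ⟨c, d, hcd⟩ := hinj
  have : Function.Injective fun w' : {w' // VecCommute Γ w w'} => (w'.1 c, w'.1 d) := by
    rintro ⟨w₁, h₁⟩ ⟨w₂, h₂⟩ h
    obtain ⟨hc, hd⟩ := Prod.ext_iff.1 h
    simp only at hc hd
    refine Subtype.ext (sub_eq_zero.1 (hcd (w₁ - w₂) (fun u v huv => ?_) ?_ ?_))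
    · simp only [Pi.sub_apply, mul_sub, sub_mul, h₁ u v huv, h₂ u v huv]
    · simp [hc]
    · simp [hd]
  refine (Nat.card_le_card_of_injective _ this).trans_eq ?_
  rw [Nat.card_prod, Nat.card_zmod, pow_two]

/-- The coordinates at `v` and at two of its neighbours are free, which gives `p ^ 3` vectors. -/
theorem lt_card_vecCommute_single [Finite X] [Fact p.Prime] (hΓ : Γ.IsNice) (v : X) (d : ZMod p) :
    p ^ 2 < Nat.card {w' // VecCommute Γ (Pi.single v d) w'} := by
  obtain ⟨a, b, hab, ha, hb⟩ := hΓ.two_neighbors v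
  let F : ZMod p × ZMod p × ZMod p → {w' // VecCommute Γ (Pi.single v d) w'} := fun t =>
    ⟨Pi.single v t.1 + Pi.single a t.2.1 + Pi.single b t.2.2, fun u u' huu' => by
      by_cases h1 : u = v
      · subst h1
        by_cases h2 : u' = u
        · subst h2; ring
        · have h3 : u' ≠ a := fun h => huu' (h ▸ ha)
          have h4 : u' ≠ b := fun h => huu' (h ▸ hb)
          simp [h2, h3, h4]
      · by_cases h2 : u' = v
        · subst h2
          have h3 : u ≠ a := fun h => huu' (h ▸ ha.symm)
          have h4 : u ≠ b := fun h => huu' (h ▸ hb.symm)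
          simp [h1, h3, h4]
        · simp [h1, h2]⟩
  have hF : Function.Injective F := by
    rintro ⟨x, y, z⟩ ⟨x', y', z'⟩ h
    have h := Subtype.ext_iff.1 h
    have hv := congrFun h v
    have ha' := congrFun h a
    have hb' := congrFun h b
    simp [F, ha.ne, hb.ne, ha.ne', hb.ne', hab, hab.symm] at hv ha' hb'
    simp [hv, ha', hb']
  refine lt_of_lt_of_le ?_ (Nat.card_le_card_of_injective F hF)
  rw [Nat.card_prod, Nat.card_prod, Nat.card_zmod, ← pow_two, ← pow_succ']
  exact Nat.pow_lt_pow_right (Fact.out : p.Prime).one_lt (by norm_num)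

/-- The elements of the form `x_v ^ d * z` with `d ≠ 0` and `z` central. -/
def OnLine (v : X) (g : MeklerModel p Γ) : Prop := ∃ d, d ≠ 0 ∧ g.vec = Pi.single v d

theorem onLine_gen (v : X) {d : ZMod p} (hd : d ≠ 0) : OnLine v (gen v d : MeklerModel p Γ) :=
  ⟨d, hd, rfl⟩

theorem OnLine.eq {u v : X} {g : MeklerModel p Γ} (hu : OnLine u g) (hv : OnLine v g) : u = v := by
  obtain ⟨d, hd, h⟩ := hu
  obtain ⟨d', hd', h'⟩ := hv
  by_contra huv
  have := congrFun (h.symm.trans h') u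
  simp [huv, hd] at this

theorem isVertexLike_iff [Finite X] [Fact p.Prime] (hΓ : Γ.IsNice) {g : MeklerModel p Γ} :
    IsVertexLike (p ^ 2 * Nat.card (NonEdge Γ → ZMod p)) (MeklerModel p Γ) g ↔
      ∃ v, OnLine v g := by
  have hpos : 0 < Nat.card (NonEdge Γ → ZMod p) := Nat.card_pos
  rw [IsVertexLike, mem_center_iff hΓ, card_commute, Nat.mul_lt_mul_right hpos]
  constructor
  · rintro ⟨h0, h1⟩
    obtain ⟨v, hv⟩ := Function.ne_iff.1 h0
    refine ⟨v, g.vec v, hv, funext fun u => ?_⟩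
    by_cases huv : u = v
    · subst huv; simp
    · rw [Pi.single_eq_of_ne huv]
      by_contra hu
      exact (card_vecCommute_le hΓ huv hu hv).not_gt h1
  · rintro ⟨v, d, hd, h⟩
    rw [h]
    exact ⟨by simpa using hd, lt_card_vecCommute_single hΓ v d⟩

theorem commute_iff_of_onLine [Fact p.Prime] {u v : X} {g h : MeklerModel p Γ} (hg : OnLine u g)
    (hh : OnLine v h) : Commute g h ↔ u = v ∨ Γ.Adj u v := by
  obtain ⟨d, hd, hg⟩ := hg
  obtain ⟨d', hd', hh⟩ := hh
  rw [commute_iff, hg, hh]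
  constructor
  · intro H
    by_contra! hcon
    have := H u v hcon.2
    simp [hcon.1, hd, hd'] at this
  · rintro (rfl | hadj) x y hxy
    · by_cases hx : x = u
      · subst hx
        by_cases hy : y = x
        · subst hy; simp [mul_comm]
        · simp [hy]
      · simp [hx]
    · by_cases hx : x = u
      · subst hx
        have hy : y ≠ v := fun h => hxy (h ▸ hadj)
        simp [hy, hadj.ne]
      · by_cases hx' : x = v
        · subst hx'
          have hy : y ≠ u := fun h => hxy (h ▸ hadj.symm)
          simp [hy, hx]
        · simp [hx, hx']

/-- The isomorphism permutes lines, and lines commute exactly when their vertices are equal or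
adjacent. Two vertices sent to the same one would have equal closed neighbourhoods; they would be
adjacent, and a second neighbour would close a triangle. -/
theorem nonempty_iso_of_mulEquiv [Finite X] [Fact p.Prime] {Δ : SimpleGraph X} (hΓ : Γ.IsNice)
    (hΔ : Δ.IsNice) (θ : MeklerModel p Γ ≃* MeklerModel p Δ) : Nonempty (Γ ≃g Δ) := by
  have hq : Nat.card (NonEdge Γ → ZMod p) = Nat.card (NonEdge Δ → ZMod p) := by
    rw [← card_center hΓ, ← card_center hΔ]
    exact Nat.card_congr (Subgroup.centerCongr θ).toEquiv
  have hf : ∀ v, ∃ v', OnLine v' (θ (gen v 1)) := fun v => by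
    have := (isVertexLike_iff hΓ).2 ⟨v, onLine_gen v (one_ne_zero (α := ZMod p))⟩
    have := this.map θ
    rw [hq] at this
    exact (isVertexLike_iff hΔ).1 this
  choose f hf using hf
  have hiff : ∀ u v, (u = v ∨ Γ.Adj u v) ↔ (f u = f v ∨ Δ.Adj (f u) (f v)) := fun u v => by
    rw [← commute_iff_of_onLine (hf u) (hf v),
      ← commute_iff_of_onLine (Γ := Γ) (onLine_gen u (one_ne_zero (α := ZMod p)))
        (onLine_gen v (one_ne_zero (α := ZMod p))), Commute, SemiconjBy, Commute, SemiconjBy,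
      ← map_mul, ← map_mul, θ.injective.eq_iff]
  have hinj : Function.Injective f := by
    intro u v huv
    by_contra hne
    have hsame : ∀ w, (u = w ∨ Γ.Adj u w) ↔ (v = w ∨ Γ.Adj v w) := fun w => by
      rw [hiff, hiff, huv]
    have huv' : Γ.Adj u v := ((hsame v).2 (Or.inl rfl)).resolve_left hne
    obtain ⟨a, b, hab, ha, hb⟩ := hΓ.two_neighbors u
    have key : ∀ a, Γ.Adj u a → a = v := fun a ha =>
      (((hsame a).1 (Or.inr ha)).resolve_right
        fun h => hΓ.no_triangle huv' h ha).symm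
    exact hab ((key a ha).trans (key b hb).symm)
  refine ⟨⟨Equiv.ofBijective f (Finite.injective_iff_bijective.1 hinj), fun {u v} => ?_⟩⟩
  change Δ.Adj (f u) (f v) ↔ Γ.Adj u v
  have := hiff u v
  by_cases h : u = v
  · subst h; simp
  · have h' : f u ≠ f v := fun h' => h (hinj h')
    simpa [h, h'] using this.symm

end MeklerModel

/-! ### Relations encoded by central elements -/

/-- Commutators of two vertex-like elements. -/
def IsElementary (K : ℕ) (G : Type*) [Group G] (z : G) : Prop :=
  ∃ a b, IsVertexLike K G a ∧ IsVertexLike K G b ∧ z = ⁅a, b⁆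

/-- Products of at most `j` commutators of vertex-like elements. -/
def elementaryProducts (K j : ℕ) (G : Type*) [Group G] : Set G :=
  (insert 1 {z | IsElementary K G z}) ^ j

/-- The relation between vertex-like elements that is encoded by `c`: multiplying `c` by the
inverse of their commutator makes it a product of `j` commutators of vertex-like elements. -/
def Linked (K j : ℕ) (G : Type*) [Group G] (c a b : G) : Prop :=
  IsVertexLike K G a ∧ IsVertexLike K G b ∧ ⁅a, b⁆ ≠ 1 ∧ ⁅a, b⁆⁻¹ * c ∈ elementaryProducts K j G

namespace WLInvariant

theorem isElementary (K : ℕ) : WLInvariant.{u} 4 fun G _ _ _ z _ _ => IsElementary K G z :=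
  (((((isVertexLike K).perm ![2, 0, 1, 3]).and (((isVertexLike K).perm ![3, 0, 1, 2]).and
    (commutator_eq.perm ![1, 2, 3, 0]))).ex.perm ![0, 1, 3, 2]).ex).congr
      fun G _ _ c z _ _ => by simp [IsElementary]

theorem mem_elementaryProducts (K : ℕ) {j k : ℕ} (hj : j ≤ 2 ^ k) :
    WLInvariant.{u} (4 + 2 * k) fun G _ _ _ z _ _ => z ∈ elementaryProducts K j G :=
  (isElementary K).pow k j hj

theorem linked (K : ℕ) {j k : ℕ} (hj : j ≤ 2 ^ k) :
    WLInvariant.{u} (6 + 2 * k) fun G _ _ c a b _ => Linked K j G c a b := by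
  have h1 : WLInvariant.{u} (5 + 2 * k) fun G _ _ c _ _ z => z⁻¹ * c ∈ elementaryProducts K j G :=
    (((((mem_elementaryProducts K hj).perm ![0, 3, 1, 2]).and
      ((mul 1 3 0).mono (Nat.zero_le _))).ex.perm ![0, 3, 1, 2]).mono (by omega)).congr
        fun G _ _ c a b z => by
          simp only [Matrix.cons_val]
          constructor
          · rintro ⟨y, hy, rfl⟩
            simpa using hy
          · intro h
            exact ⟨_, h, by group⟩
  have h2 : WLInvariant.{u} (6 + 2 * k) fun G _ _ c a b _ =>
      ∃ z, z = ⁅a, b⁆ ∧ z ≠ 1 ∧ z⁻¹ * c ∈ elementaryProducts K j G :=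
    (((commutator_eq.perm ![3, 1, 2, 0]).mono (by omega)).and
      (((eq_one.not.perm ![3, 0, 1, 2]).mono (Nat.zero_le _)).and h1)).ex.mono (by omega)
  refine ((((isVertexLike K).perm ![1, 0, 2, 3]).mono (by omega)).and
    ((((isVertexLike K).perm ![2, 0, 1, 3]).mono (by omega)).and h2)).congr fun G _ _ c a b _ => ?_
  simp [Linked]

theorem card_linked (K : ℕ) {j k : ℕ} (hj : j ≤ 2 ^ k) (n : ℕ) :
    WLInvariant.{u} (7 + 2 * k) fun G _ _ c a _ _ => Nat.card {b // Linked K j G c a b} = n :=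
  ((((linked K hj).perm ![0, 1, 3, 2]).card (fun l => l = n)).mono (by omega))

end WLInvariant

namespace MeklerModel

variable {X : Type*} [LinearOrder X] {p : ℕ} {Γ : SimpleGraph X}

/-- The pair of non-adjacent vertices `u` and `v`. -/
def nonEdge {u v : X} (huv : u ≠ v) (h : ¬ Γ.Adj u v) : NonEdge Γ :=
  if hlt : u < v then ⟨(u, v), hlt, h⟩
  else ⟨(v, u), lt_of_le_of_ne (not_lt.1 hlt) huv.symm, fun h' => h h'.symm⟩

/-- The sign of a pair of vertices. -/
def pairSign (p : ℕ) (u v : X) : ZMod p := if u < v then 1 else -1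

theorem pairSign_ne_zero [Fact p.Prime] (u v : X) : pairSign p u v ≠ 0 := by
  rw [pairSign]
  split_ifs <;> simp

theorem commutator_of_vec_eq_single {u v : X} (huv : u ≠ v) (h : ¬ Γ.Adj u v) {d d' : ZMod p}
    {g g' : MeklerModel p Γ} (hg : g.vec = Pi.single u d) (hg' : g'.vec = Pi.single v d') :
    ⁅g, g'⁆ = emb (Multiplicative.ofAdd (Pi.single (nonEdge huv h) (pairSign p u v * d * d'))) := by
  have h1 : ⁅g, g'⁆ = ⁅(gen u d : MeklerModel p Γ), gen v d'⁆ := by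
    rw [MeklerModel.commutator_eq, MeklerModel.commutator_eq, hg, hg']
    rfl
  rw [h1]
  by_cases hlt : u < v
  · simpa [nonEdge, pairSign, hlt] using commutator_gen_gen ⟨(u, v), hlt, h⟩ d d'
  · have hlt' : v < u := lt_of_le_of_ne (not_lt.1 hlt) huv.symm
    have := commutator_gen_gen (Γ := Γ) ⟨(v, u), hlt', fun h' => h h'.symm⟩ d' d
    rw [← commutatorElement_inv, this, ← map_inv, ← ofAdd_neg, ← Pi.single_neg]
    simp [nonEdge, pairSign, hlt, mul_comm]

/-- The central element encoding a relation on the vertices. -/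
noncomputable def code (p : ℕ) (Γ : SimpleGraph X) (T : X → X → Prop) : MeklerModel p Γ :=
  open Classical in emb (Multiplicative.ofAdd fun e => if T e.1.1 e.1.2 then 1 else 0)

variable [Finite X]

theorem exists_emb_of_isElementary [Fact p.Prime] (hΓ : Γ.IsNice) {z : MeklerModel p Γ}
    (hz : IsElementary (p ^ 2 * Nat.card (NonEdge Γ → ZMod p)) (MeklerModel p Γ) z) :
    z = 1 ∨ ∃ e d, z = emb (Multiplicative.ofAdd (Pi.single e d)) := by
  obtain ⟨a, b, ha, hb, rfl⟩ := hz
  obtain ⟨u, ha⟩ := (isVertexLike_iff hΓ).1 ha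
  obtain ⟨v, hb⟩ := (isVertexLike_iff hΓ).1 hb
  by_cases h : u = v ∨ Γ.Adj u v
  · left
    rwa [commutatorElement_eq_one_iff_commute, commute_iff_of_onLine ha hb]
  · right
    push Not at h
    obtain ⟨d, -, ha⟩ := ha
    obtain ⟨d', -, hb⟩ := hb
    exact ⟨_, _, commutator_of_vec_eq_single h.1 h.2 ha hb⟩

theorem isElementary_emb_single [Fact p.Prime] (hΓ : Γ.IsNice) (e : NonEdge Γ) {d : ZMod p}
    (hd : d ≠ 0) : IsElementary (p ^ 2 * Nat.card (NonEdge Γ → ZMod p)) (MeklerModel p Γ)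
      (emb (Multiplicative.ofAdd (Pi.single e d))) :=
  ⟨gen e.1.1 d, gen e.1.2 1, (isVertexLike_iff hΓ).2 ⟨_, onLine_gen _ hd⟩,
    (isVertexLike_iff hΓ).2 ⟨_, onLine_gen _ one_ne_zero⟩, by rw [commutator_gen_gen, mul_one]⟩

theorem emb_mem_elementaryProducts [Fact p.Prime] (hΓ : Γ.IsNice) (s : Finset (NonEdge Γ))
    (z : NonEdge Γ → ZMod p) (hz : ∀ e ∉ s, z e = 0) :
    emb (Multiplicative.ofAdd z) ∈ elementaryProducts (p ^ 2 * Nat.card (NonEdge Γ → ZMod p)) s.card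
      (MeklerModel p Γ) := by
  refine emb_mem_pow (fun e d => ?_) s z hz
  by_cases hd : d = 0
  · left
    subst hd
    simp
  · exact Or.inr (isElementary_emb_single hΓ e hd)

/-- A commutator of two line elements touches at most one central coordinate. Together with
`emb_mem_elementaryProducts` this identifies word length with support size. -/
theorem ncard_support_le_of_mem_elementaryProducts [Fact p.Prime] (hΓ : Γ.IsNice) {j : ℕ}
    {g : MeklerModel p Γ}
    (hg : g ∈ elementaryProducts (p ^ 2 * Nat.card (NonEdge Γ → ZMod p)) j (MeklerModel p Γ)) :
    g.vec = 0 ∧ (Function.support g.cen).ncard ≤ j := by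
  induction j generalizing g with
  | zero =>
    rw [elementaryProducts, pow_zero, Set.mem_one] at hg
    simp [hg]
  | succ j ih =>
    rw [elementaryProducts, pow_succ] at hg
    obtain ⟨a, ha, b, hb, rfl⟩ := hg
    obtain ⟨h1, h2⟩ := ih ha
    have hb' : b = 1 ∨ ∃ e d, b = emb (Multiplicative.ofAdd (Pi.single e d)) := by
      rcases hb with hb | hb
      · exact Or.inl hb
      · exact exists_emb_of_isElementary hΓ hb
    rcases hb' with rfl | ⟨e, d, rfl⟩
    · simp only [mul_one]
      exact ⟨h1, by omega⟩
    · refine ⟨by simp [h1], ?_⟩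
      have hsub : Function.support
          (a * (emb (Multiplicative.ofAdd (Pi.single e d)) : MeklerModel p Γ)).cen ⊆
            insert e (Function.support a.cen) := by
        intro f hf
        by_cases hfe : f = e
        · exact Or.inl hfe
        · right
          simpa [hfe, h1] using hf
      exact ((Set.ncard_le_ncard hsub (Set.toFinite _)).trans (Set.ncard_insert_le _ _)).trans
        (by omega)

/-- `code p Γ T` has support of size `m`, the number of pairs in `T`, with all entries 1.
Subtracting one entry `k` leaves support `m - 1` only if the entry lies in `T` and `k = 1`; another
value keeps the support, and an entry outside `T` enlarges it. The condition `k = 1` fixes the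
exponent of `b`. -/
theorem linked_code_iff [Fact p.Prime] (hΓ : Γ.IsNice) {T : X → X → Prop}
    (hT : ∀ u v, T u v → T v u ∧ u ≠ v ∧ ¬ Γ.Adj u v) {u : X} {d : ZMod p} (hd : d ≠ 0)
    {a b : MeklerModel p Γ} (ha : a.vec = Pi.single u d) :
    Linked (p ^ 2 * Nat.card (NonEdge Γ → ZMod p)) ({e : NonEdge Γ | T e.1.1 e.1.2}.ncard - 1)
      (MeklerModel p Γ) (code p Γ T) a b ↔
      ∃ v, T u v ∧ b.vec = Pi.single v (pairSign p u v * d)⁻¹ := by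
  classical
  have hua : OnLine u a := ⟨d, hd, ha⟩
  have hTe : ∀ {v : X} (huv : u ≠ v) (h : ¬ Γ.Adj u v),
      T (nonEdge huv h).1.1 (nonEdge huv h).1.2 ↔ T u v := by
    intro v huv h
    unfold nonEdge
    split_ifs
    · rfl
    · exact ⟨fun h => (hT _ _ h).1, fun h => (hT _ _ h).1⟩
  have hcode : ∀ (e : NonEdge Γ) (k : ZMod p),
      (emb (Multiplicative.ofAdd (Pi.single e k)))⁻¹ * code p Γ T = emb (Multiplicative.ofAdd
        ((fun e => if T e.1.1 e.1.2 then 1 else 0) - Pi.single e k)) := by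
    intro e k
    rw [code, ← map_inv, ← map_mul, ← ofAdd_neg, ← ofAdd_add, neg_add_eq_sub]
  constructor
  · rintro ⟨-, hb, h1, h2⟩
    obtain ⟨v, hvb⟩ := (isVertexLike_iff hΓ).1 hb
    rw [Ne, commutatorElement_eq_one_iff_commute, commute_iff_of_onLine hua hvb] at h1
    push Not at h1
    obtain ⟨d', hd', hb⟩ := hvb
    rw [commutator_of_vec_eq_single h1.1 h1.2 ha hb, hcode] at h2
    have h3 := (ncard_support_le_of_mem_elementaryProducts hΓ h2).2
    set e := nonEdge h1.1 h1.2 with he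
    have hk0 : pairSign p u v * d * d' ≠ 0 := mul_ne_zero (mul_ne_zero (pairSign_ne_zero u v) hd) hd'
    set k := pairSign p u v * d * d' with hk
    rw [cen_emb, toAdd_ofAdd] at h3
    by_cases huv : T u v
    · refine ⟨v, huv, ?_⟩
      have hk1 : k = 1 := by
        by_contra hk1
        have hsub : {e : NonEdge Γ | T e.1.1 e.1.2} ⊆ Function.support
            ((fun e : NonEdge Γ => if T e.1.1 e.1.2 then (1 : ZMod p) else 0) - Pi.single e k) := by
          intro f hf
          rw [Function.mem_support, Pi.sub_apply, if_pos (Set.mem_ofPred.1 hf)]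
          by_cases hfe : f = e
          · rw [hfe, Pi.single_eq_same]
            exact sub_ne_zero.2 (Ne.symm hk1)
          · simp [hfe]
        have h4 := Set.ncard_le_ncard hsub (Set.toFinite _)
        -- Positivity is needed because the bound `ncard - 1` is a truncated subtraction.
        have h5 : 0 < {e : NonEdge Γ | T e.1.1 e.1.2}.ncard :=
          (Set.ncard_pos (Set.toFinite _)).2 ⟨e, (hTe h1.1 h1.2).2 huv⟩
        omega
      rw [hb, eq_inv_of_mul_eq_one_right hk1]
    · exfalso
      have hne : e ∉ {e : NonEdge Γ | T e.1.1 e.1.2} := fun h => huv ((hTe h1.1 h1.2).1 h)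
      have hsub : insert e {e : NonEdge Γ | T e.1.1 e.1.2} ⊆ Function.support
          ((fun e : NonEdge Γ => if T e.1.1 e.1.2 then (1 : ZMod p) else 0) - Pi.single e k) := by
        rintro f (rfl | hf)
        · rw [Function.mem_support, Pi.sub_apply, if_neg (Set.notMem_ofPred_iff.1 hne), Pi.single_eq_same]
          simpa using hk0
        · have hfe : f ≠ e := fun h => hne (h ▸ hf)
          rw [Function.mem_support, Pi.sub_apply, if_pos (Set.mem_ofPred.1 hf)]
          simp [hfe]
      have h4 := Set.ncard_le_ncard hsub (Set.toFinite _)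
      rw [Set.ncard_insert_of_notMem hne (Set.toFinite _)] at h4
      omega
  · rintro ⟨v, huv, hb⟩
    obtain ⟨-, h1, h2⟩ := hT u v huv
    have hs : pairSign p u v * d ≠ 0 := mul_ne_zero (pairSign_ne_zero u v) hd
    have hvb : OnLine v b := ⟨_, inv_ne_zero hs, hb⟩
    refine ⟨(isVertexLike_iff hΓ).2 ⟨u, hua⟩, (isVertexLike_iff hΓ).2 ⟨v, hvb⟩, ?_, ?_⟩
    · rw [Ne, commutatorElement_eq_one_iff_commute, commute_iff_of_onLine hua hvb]
      push Not
      exact ⟨h1, h2⟩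
    · rw [commutator_of_vec_eq_single h1 h2 ha hb, hcode, mul_inv_cancel₀ hs]
      have := Fintype.ofFinite (NonEdge Γ)
      set e := nonEdge h1 h2 with he
      have hmem : T e.1.1 e.1.2 := (hTe h1 h2).2 huv
      have hcard : {e : NonEdge Γ | T e.1.1 e.1.2}.ncard - 1 =
          ((Finset.univ.filter fun e : NonEdge Γ => T e.1.1 e.1.2).erase e).card := by
        rw [Finset.card_erase_of_mem (by simpa using hmem), Set.ncard_eq_toFinset_card']
        simp
      rw [hcard]
      refine emb_mem_elementaryProducts hΓ _ _ fun f hf => ?_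
      by_cases hfe : f = e
      · rw [hfe, Pi.sub_apply, if_pos hmem, Pi.single_eq_same, sub_self]
      · have : ¬ T f.1.1 f.1.2 := fun h => hf (by simp [hfe, h])
        simp [hfe, this]

/-- A linked element has its vertex part fixed by the choice of a `T`-neighbour of `u`, while its
central part is arbitrary; so the count is the degree times the order of the centre. -/
theorem card_linked_code [Fact p.Prime] (hΓ : Γ.IsNice) {T : X → X → Prop}
    (hT : ∀ u v, T u v → T v u ∧ u ≠ v ∧ ¬ Γ.Adj u v) {u : X} {a : MeklerModel p Γ}
    (ha : OnLine u a) :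
    Nat.card {b // Linked (p ^ 2 * Nat.card (NonEdge Γ → ZMod p))
      ({e : NonEdge Γ | T e.1.1 e.1.2}.ncard - 1) (MeklerModel p Γ) (code p Γ T) a b} =
      {v | T u v}.ncard * Nat.card (NonEdge Γ → ZMod p) := by
  obtain ⟨d, hd, ha⟩ := ha
  rw [← Nat.card_coe_set_eq {v | T u v}, ← Nat.card_prod]
  symm
  have hs : ∀ v, (pairSign p u v * d)⁻¹ ≠ 0 := fun v =>
    inv_ne_zero (mul_ne_zero (pairSign_ne_zero u v) hd)
  refine Nat.card_congr (Equiv.ofBijective (fun x : {v | T u v} × (NonEdge Γ → ZMod p) =>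
    ⟨⟨Pi.single x.1.1 (pairSign p u x.1.1 * d)⁻¹, x.2⟩,
      (linked_code_iff hΓ hT hd ha).2 ⟨x.1.1, x.1.2, rfl⟩⟩) ⟨?_, ?_⟩)
  · rintro ⟨⟨v, hv⟩, z⟩ ⟨⟨v', hv'⟩, z'⟩ h
    have h := Subtype.ext_iff.1 h
    have h1 := (MeklerModel.ext_iff.1 h).1
    have h2 := (MeklerModel.ext_iff.1 h).2
    have : v = v' := OnLine.eq (g := (⟨_, z⟩ : MeklerModel p Γ)) ⟨_, hs v, rfl⟩ ⟨_, hs v', h1⟩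
    subst this
    simp only at h2
    rw [h2]
  · rintro ⟨b, hb⟩
    obtain ⟨v, hv, hbv⟩ := (linked_code_iff hΓ hT hd ha).1 hb
    exact ⟨(⟨v, hv⟩, b.cen), Subtype.ext (MeklerModel.ext hbv.symm rfl)⟩

end MeklerModel

/-! ### Recognising Mekler's groups -/

theorem Subgroup.set_pow_subset {G : Type*} [Group G] (K : Subgroup G) {S : Set G}
    (hS : S ⊆ K) (n : ℕ) : S ^ n ⊆ K := by
  induction n with
  | zero => simp [K.one_mem]
  | succ n ih =>
    rw [pow_succ]
    rintro _ ⟨a, ha, b, hb, rfl⟩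
    exact K.mul_mem (ih ha) (hS hb)

theorem commutator_mul_center {G : Type*} [Group G] {a b y z : G} (hy : y ∈ Subgroup.center G)
    (hz : z ∈ Subgroup.center G) : ⁅a * y, b * z⁆ = ⁅a, b⁆ := by
  have hy' := Subgroup.mem_center_iff.1 hy
  have hz' := Subgroup.mem_center_iff.1 hz
  simp only [commutatorElement_def, mul_inv_rev]
  calc a * y * (b * z) * (y⁻¹ * a⁻¹) * (z⁻¹ * b⁻¹)
      = a * (y * (b * z)) * y⁻¹ * a⁻¹ * z⁻¹ * b⁻¹ := by group
    _ = a * b * (z * a⁻¹) * z⁻¹ * b⁻¹ := by rw [← hy']; group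
    _ = a * b * a⁻¹ * b⁻¹ := by rw [← hz']; group

namespace WLInvariant

theorem commutator_mem_center :
    WLInvariant.{u} 5 fun G _ _ _ _ _ _ => ∀ a b : G, ⁅a, b⁆ ∈ Subgroup.center G := by
  refine (((((commutator_eq.perm ![3, 1, 2, 0]).imp (central.perm ![3, 0, 1, 2])).all.perm
    ![0, 1, 3, 2]).all.perm ![0, 3, 1, 2]).all).congr fun G _ _ _ _ _ _ => ?_
  simp

theorem center_subset_pow {j k : ℕ} (hj : j ≤ 2 ^ k) :
    WLInvariant.{u} (5 + 2 * k) fun G _ _ _ _ _ _ => ∀ z ∈ Subgroup.center G,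
      z ∈ (insert 1 {x : G | ∃ a b : G, x = ⁅a, b⁆}) ^ j := by
  have h : WLInvariant.{u} 4 fun G _ _ _ x _ _ => ∃ a b : G, x = ⁅a, b⁆ :=
    ((commutator_eq.perm ![1, 2, 3, 0]).ex.perm ![0, 1, 3, 2]).ex
  have h' := h.pow k j hj
  exact ((((central.perm ![3, 0, 1, 2]).mono (by omega)).imp (h'.perm ![0, 3, 1, 2])).all).mono
    (by omega)

variable {r : ℕ} {Φ : ∀ (G : Type u) [Group G] [Fintype G], G → G → Prop}

theorem forall_commute (hΦ : WLInvariant r fun G _ _ c g _ _ => Φ G c g) :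
    WLInvariant (r + 2) fun G _ _ c g _ _ => ∀ g', Φ G c g' → Commute g g' :=
  (((hΦ.perm ![0, 3, 1, 2]).mono (Nat.le_succ r)).imp
    ((commute.perm ![1, 3, 0, 2]).mono (Nat.le_add_left 1 r))).all

theorem forall_exists_pow (hΦ : WLInvariant r fun G _ _ c g _ _ => Φ G c g) {p l : ℕ}
    (hp : p ≤ 2 ^ 2 ^ l) :
    WLInvariant (r + 3 * l + 5) fun G _ _ c g _ _ => ∀ g', Φ G c g' →
      ∃ i ≤ p, (g ^ i)⁻¹ * g' ∈ Subgroup.center G := by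
  have h1 : WLInvariant.{u} 3 fun G _ _ _ _ g' y => y⁻¹ * g' ∈ Subgroup.center G := by
    refine (((central.perm ![3, 0, 1, 2]).and ((mul 0 3 1).mono (Nat.zero_le _))).ex.perm
      ![3, 2, 1, 0]).congr fun G _ _ _ _ g' y => ?_
    simp only [Matrix.cons_val]
    constructor
    · rintro ⟨z, hz, rfl⟩
      simpa using hz
    · intro h
      exact ⟨_, h, by group⟩
  have h2 : WLInvariant.{u} (3 * l) fun G _ _ _ g _ y => ∃ i : {i // i ≤ p}, y = g ^ i.1 :=
    exists_index fun i => (eq_pow l i.1 (i.2.trans hp)).perm ![1, 3, 0, 2]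
  have h3 : WLInvariant.{u} (3 * l + 4) fun G _ _ _ g g' _ =>
      ∃ i ≤ p, (g ^ i)⁻¹ * g' ∈ Subgroup.center G := by
    refine ((h2.mono (Nat.le_add_right _ 3)).and (h1.mono (Nat.le_add_left _ _))).ex.congr
      fun G _ _ _ g g' _ => ?_
    constructor
    · rintro ⟨_, ⟨⟨i, hi⟩, rfl⟩, h⟩
      exact ⟨i, hi, h⟩
    · rintro ⟨i, hi, h⟩
      exact ⟨_, ⟨⟨i, hi⟩, rfl⟩, h⟩
  have h4 : WLInvariant (r + 3 * l + 4) fun G _ _ c g _ g' =>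
      Φ G c g' → ∃ i ≤ p, (g ^ i)⁻¹ * g' ∈ Subgroup.center G :=
    ((hΦ.perm ![0, 3, 1, 2]).mono (by omega)).imp ((h3.perm ![0, 1, 3, 2]).mono (by omega))
  exact h4.all

theorem forall_mem_pow {ι : Type*}
    {Ψ : ι → ∀ (G : Type u) [Group G] [Fintype G], G → G → Prop}
    (hΨ : ∀ v, WLInvariant r fun G _ _ c g _ _ => Ψ v G c g) {j k : ℕ} (hj : j ≤ 2 ^ k) :
    WLInvariant (r + 3 + 2 * k) fun G _ _ c _ _ _ => ∀ g : G,
      g ∈ (insert 1 {x : G | x ∈ Subgroup.center G ∨ ∃ v, Ψ v G c x}) ^ j := by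
  have h : WLInvariant (r + 2) fun G _ _ c x _ _ => x ∈ Subgroup.center G ∨ ∃ v, Ψ v G c x :=
    ((central.perm ![1, 0, 2, 3]).mono (by omega)).or
      (exists_index fun v => (hΨ v).mono (by omega))
  exact ((h.pow k j hj).perm ![0, 3, 1, 2]).all.mono (by omega)

end WLInvariant

open MeklerModel

/-- Only the pair `(c, g)` is ever carried from the model to `H`. Whatever relates several vertices
has to be phrased as a property of one element over `c`, with the others quantified inside their
defining formulas `Φ v`. -/
theorem nonempty_mulEquiv_of_wlColors_eq {X : Type u} [LinearOrder X] [Fintype X] {p : ℕ}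
    [Fact p.Prime] {Γ : SimpleGraph X} (hΓ : Γ.IsNice) (c : MeklerModel p Γ)
    {Φ : X → ∀ (G : Type u) [Group G] [Fintype G], G → G → Prop} {r k l R : ℕ}
    (hΦ : ∀ v, WLInvariant r fun G _ _ c g _ _ => Φ v G c g)
    (hc : ∀ v g, Φ v (MeklerModel p Γ) c g ↔ OnLine v g) (hX : Fintype.card X + 1 ≤ 2 ^ k)
    (hN : Nat.card (NonEdge Γ) ≤ 2 ^ k) (hp : p ≤ 2 ^ 2 ^ l) (hR : r + 3 * l + 2 * k + 6 ≤ R)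
    {H : Type u} [Group H] [Fintype H]
    (h : wlColors (groupInitialColor (MeklerModel p Γ) 3) R = wlColors (groupInitialColor H 3) R) :
    Nonempty (MeklerModel p Γ ≃* H) := by
  classical
  obtain ⟨c', hcc'⟩ := Pebble.of_wlColors_eq h c
  -- One round is spent on `σ`, which supplies the partners of all generators at once.
  obtain ⟨R, rfl⟩ : ∃ R', R = R' + 1 := ⟨R - 1, by omega⟩
  obtain ⟨σ, hσ⟩ := hcc'.exists_equiv
  have one_ne : (1 : ZMod p) ≠ 0 := one_ne_zero
  have hclass : ∀ a b : H, ⁅a, b⁆ ∈ Subgroup.center H :=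
    (WLInvariant.commutator_mem_center.iff (hcc'.mono (by omega))).1 fun a b =>
      mem_center_of_vec_eq_zero (by rw [MeklerModel.commutator_eq])
  have transfer : ∀ {Ψ : ∀ (G : Type u) [Group G] [Fintype G], G → G → Prop} {s : ℕ},
      WLInvariant s (fun G _ _ c g _ _ => Ψ G c g) → s ≤ R → ∀ g,
        Ψ (MeklerModel p Γ) c g → Ψ H c' (σ g) := fun hΨ hs g =>
    (hΨ.iff (((hσ g).comp ![0, 3, 0, 0]).mono hs)).1
  let y : X → H := fun v => σ (gen v 1)
  have hy : ∀ v, Φ v H c' (y v) := fun v =>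
    transfer (hΦ v) (by omega) _ ((hc v _).2 (onLine_gen v one_ne))
  have hypow : ∀ v, y v ^ p = 1 := fun v =>
    transfer (Ψ := fun G _ _ _ g => g ^ p = 1)
      ((WLInvariant.pow_eq_one l p hp).perm ![1, 0, 2, 3]) (by omega) _
      (by rw [gen_pow]; simp [gen_zero])
  -- The pair `(y u, y v)` is not compared with anything: the property transferred to `y u` is that
  -- it commutes with everything satisfying `Φ v`, and `y v` is an instance.
  have hyadj : ∀ u v, Γ.Adj u v → Commute (y u) (y v) := fun u v huv =>
    transfer (hΦ v).forall_commute (by omega) (gen u 1) (fun g' hg' =>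
      (commute_iff_of_onLine (onLine_gen u one_ne) ((hc v g').1 hg')).2 (Or.inr huv)) (y v) (hy v)
  have hyline : ∀ v g', Φ v H c' g' → ∃ i ≤ p, (y v ^ i)⁻¹ * g' ∈ Subgroup.center H := fun v =>
    transfer ((hΦ v).forall_exists_pow hp) (by omega) (gen v 1) fun g' hg' => by
      obtain ⟨d, -, hd⟩ := (hc v g').1 hg'
      refine ⟨d.val, (ZMod.val_lt d).le, mem_center_of_vec_eq_zero ?_⟩
      rw [gen_pow]
      simp [hd]
  let ψ : MeklerGroup p Γ →* H := PresentedGroup.toGroup (f := y) (by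
    rintro _ ((⟨i, rfl⟩ | ⟨i, j, l, rfl⟩) | ⟨i, j, hij, rfl⟩)
    · simp [hypow]
    · simp only [map_commutatorElement, FreeGroup.lift_apply_of]
      rw [commutatorElement_eq_one_iff_commute]
      exact (Subgroup.mem_center_iff.1 (hclass _ _) _).symm
    · simp only [map_commutatorElement, FreeGroup.lift_apply_of]
      rw [commutatorElement_eq_one_iff_commute]
      exact hyadj i j hij)
  have hψ : ∀ v, y v ∈ ψ.range := fun v => ⟨PresentedGroup.of v, PresentedGroup.toGroup.of _⟩
  have htop : ∀ g : H, g ∈ ψ.range ⊔ Subgroup.center H := by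
    have hM : ∀ g : MeklerModel p Γ, g ∈ (insert 1 {x : MeklerModel p Γ |
        x ∈ Subgroup.center (MeklerModel p Γ) ∨ ∃ v, Φ v (MeklerModel p Γ) c x}) ^
          (Fintype.card X + 1) := by
      refine fun g => mem_pow_of_vec (fun v d => ?_) (fun g hg => Or.inr (Or.inl
        (mem_center_of_vec_eq_zero hg))) Finset.univ g (by simp)
      by_cases hd : d = 0
      · left
        rw [hd, gen_zero]
      · exact Or.inr (Or.inr ⟨v, (hc v _).2 (onLine_gen v hd)⟩)
    have := ((WLInvariant.forall_mem_pow hΦ hX).iff (hcc'.mono (by omega))).1 hM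
    refine fun g => Subgroup.set_pow_subset _ ?_ _ (this g)
    rintro x (rfl | hx | ⟨v, hx⟩)
    · exact Subgroup.one_mem _
    · exact Subgroup.mem_sup_right hx
    · obtain ⟨i, -, hi⟩ := hyline v x hx
      have := Subgroup.mul_mem _ (Subgroup.mem_sup_left (Subgroup.pow_mem _ (hψ v) i))
        (Subgroup.mem_sup_right hi (S := ψ.range))
      simpa using this
  -- Central factors cancel in a commutator, so generation modulo the centre already puts every
  -- commutator into the range. This is then used to capture the centre itself.
  have hcomm : ∀ a b : H, ⁅a, b⁆ ∈ ψ.range := fun a b => by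
    obtain ⟨a, ha, z, hz, rfl⟩ := Subgroup.mem_sup_of_normal_right.1 (htop a)
    obtain ⟨b, hb, z', hz', rfl⟩ := Subgroup.mem_sup_of_normal_right.1 (htop b)
    rw [commutator_mul_center hz hz', commutatorElement_def]
    exact Subgroup.mul_mem _ (Subgroup.mul_mem _ (Subgroup.mul_mem _ ha hb)
      (Subgroup.inv_mem _ ha)) (Subgroup.inv_mem _ hb)
  have hcenter : Subgroup.center H ≤ ψ.range := by
    have hM : ∀ z ∈ Subgroup.center (MeklerModel p Γ),
        z ∈ (insert 1 {x : MeklerModel p Γ | ∃ a b : MeklerModel p Γ, x = ⁅a, b⁆}) ^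
          Nat.card (NonEdge Γ) := by
      intro z hz
      have hz : z = emb (Multiplicative.ofAdd z.cen) := by
        ext <;> simp [(mem_center_iff hΓ).1 hz]
      rw [hz, Nat.card_eq_fintype_card]
      refine emb_mem_pow (fun e d => Or.inr ⟨gen e.1.1 d, gen e.1.2 1, ?_⟩) Finset.univ _ (by simp)
      rw [commutator_gen_gen, mul_one]
    have := ((WLInvariant.center_subset_pow hN).iff (hcc'.mono (by omega))).1 hM
    refine fun g hg => Subgroup.set_pow_subset _ ?_ _ (this g hg)
    rintro x (rfl | ⟨a, b, rfl⟩)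
    · exact Subgroup.one_mem _
    · exact hcomm a b
  have hsurj : Function.Surjective ψ := fun g => sup_le le_rfl hcenter (htop g)
  have hcard : Nat.card (MeklerGroup p Γ) = Nat.card H :=
    (Nat.card_congr meklerEquivModel.toEquiv).trans (Nat.card_congr σ)
  exact ⟨meklerEquivModel.symm.trans (MulEquiv.ofBijective ψ
    ((Nat.bijective_iff_surjective_and_card ψ).2 ⟨hsurj, hcard⟩))⟩

/-! ### Making the vertices definable -/

/-- An enumerated independent set such that every other vertex has two neighbours in it, with three
marked vertices. -/
structure Skeleton {X : Type*} (Γ : SimpleGraph X) where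
  I : Finset X
  pos : X → ℕ
  t : X
  t' : X
  w : X
  indep : ∀ {u v}, u ∈ I → v ∈ I → ¬ Γ.Adj u v
  two_neighbors : ∀ {u}, u ∉ I → ∃ a ∈ I, ∃ b ∈ I, a ≠ b ∧ Γ.Adj u a ∧ Γ.Adj u b
  pos_lt : ∀ {u}, u ∈ I → pos u < I.card
  pos_inj : ∀ {u v}, u ∈ I → v ∈ I → pos u = pos v → u = v
  t_mem : t ∈ I
  t'_mem : t' ∈ I
  w_mem : w ∈ I
  w_ne : w ≠ t
  w_ne' : w ≠ t'
  pos_t : pos t + 1 = I.card / 2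
  pos_t' : pos t' = I.card / 2
  common : ∃ y, Γ.Adj t y ∧ Γ.Adj w y
  no_common : ∀ y, Γ.Adj t' y → ¬ Γ.Adj w y

namespace Skeleton

variable {X : Type*} {Γ : SimpleGraph X} (S : Skeleton Γ)

/-- The threshold graph on the independent set. -/
def Thr (u v : X) : Prop := u ∈ S.I ∧ v ∈ S.I ∧ u ≠ v ∧ S.I.card ≤ S.pos u + S.pos v + 1

/-- The degrees of the threshold graph. -/
noncomputable def deg (u : X) : ℕ := {v | S.Thr u v}.ncard

theorem thr_spec (u v : X) (h : S.Thr u v) : S.Thr v u ∧ u ≠ v ∧ ¬ Γ.Adj u v :=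
  ⟨⟨h.2.1, h.1, h.2.2.1.symm, by have := h.2.2.2; omega⟩, h.2.2.1, S.indep h.1 h.2.1⟩

theorem deg_of_notMem {u : X} (hu : u ∉ S.I) : S.deg u = 0 := by
  have : {v | S.Thr u v} = ∅ := Set.eq_empty_of_forall_notMem fun v hv => hu hv.1
  rw [deg, this, Set.ncard_empty]

/-- The positions meeting the threshold with `u` are the last `pos u + 1`. In the upper half `u` is
among them and has to be discarded. -/
theorem deg_of_mem {u : X} (hu : u ∈ S.I) :
    S.deg u = if S.I.card ≤ 2 * S.pos u + 1 then S.pos u else S.pos u + 1 := by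
  classical
  have himage : S.I.image S.pos = Finset.range S.I.card := by
    refine Finset.eq_of_subset_of_card_le ?_ ?_
    · intro x hx
      obtain ⟨v, hv, rfl⟩ := Finset.mem_image.1 hx
      exact Finset.mem_range.2 (S.pos_lt hv)
    · rw [Finset.card_image_of_injOn fun a ha b hb => S.pos_inj ha hb, Finset.card_range]
  have hlt := S.pos_lt hu
  have hcard : (S.I.filter fun v => S.I.card ≤ S.pos u + S.pos v + 1).card = S.pos u + 1 := by
    rw [← Finset.card_image_of_injOn (f := S.pos) fun a ha b hb => S.pos_inj
      (Finset.mem_filter.1 ha).1 (Finset.mem_filter.1 hb).1]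
    have : (S.I.filter fun v => S.I.card ≤ S.pos u + S.pos v + 1).image S.pos =
        Finset.Ico (S.I.card - (S.pos u + 1)) S.I.card := by
      ext j
      simp only [Finset.mem_image, Finset.mem_filter, Finset.mem_Ico]
      constructor
      · rintro ⟨v, ⟨hv, h⟩, rfl⟩
        have := S.pos_lt hv
        omega
      · rintro ⟨h1, h2⟩
        obtain ⟨v, hv, rfl⟩ := Finset.mem_image.1 (himage ▸ Finset.mem_range.2 h2)
        exact ⟨v, ⟨hv, by omega⟩, rfl⟩
    rw [this, Nat.card_Ico]
    omega
  have hset : {v | S.Thr u v} =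
      ((S.I.filter fun v => S.I.card ≤ S.pos u + S.pos v + 1).erase u : Finset X) := by
    ext v
    simp only [Thr, Set.mem_ofPred, Finset.coe_erase, Finset.coe_filter, Set.mem_sdiff,
      Set.mem_singleton_iff]
    tauto
  rw [deg, hset, Set.ncard_coe_finset]
  split_ifs with h
  · rw [Finset.card_erase_of_mem (Finset.mem_filter.2 ⟨hu, by omega⟩), hcard]
    rfl
  · rw [Finset.erase_eq_of_notMem, hcard]
    intro h'
    have := (Finset.mem_filter.1 h').2
    omega

theorem deg_pos {u : X} (hu : u ∈ S.I) : 0 < S.deg u := by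
  rw [S.deg_of_mem hu]
  have := S.pos_t
  split_ifs <;> omega

/-- With `m = I.card`, positions below `m / 2` have degree one more than the position and the others
have degree equal to it. Both halves are injective, and their values meet only at `m / 2`, attained
by the two middle positions. -/
theorem eq_or_twins {u v : X} (hu : u ∈ S.I) (h : S.deg u = S.deg v) :
    u = v ∨ (u = S.t ∧ v = S.t') ∨ (u = S.t' ∧ v = S.t) := by
  have hv : v ∈ S.I := by
    by_contra hv
    have := S.deg_pos hu
    rw [h, S.deg_of_notMem hv] at this
    exact this.false
  rw [S.deg_of_mem hu, S.deg_of_mem hv] at h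
  have h1 := S.pos_t
  have h2 := S.pos_t'
  have h3 : S.pos u = S.pos v ∨ (S.pos u = S.pos S.t ∧ S.pos v = S.pos S.t') ∨
      (S.pos u = S.pos S.t' ∧ S.pos v = S.pos S.t) := by
    split_ifs at h <;> omega
  rcases h3 with h3 | ⟨h3, h4⟩ | ⟨h3, h4⟩
  · exact Or.inl (S.pos_inj hu hv h3)
  · exact Or.inr (Or.inl ⟨S.pos_inj hu S.t_mem h3, S.pos_inj hv S.t'_mem h4⟩)
  · exact Or.inr (Or.inr ⟨S.pos_inj hu S.t'_mem h3, S.pos_inj hv S.t_mem h4⟩)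

end Skeleton

/-- Vertex-like elements with a given number of linked elements. -/
def HasLinks (K j n : ℕ) (G : Type*) [Group G] (c g : G) : Prop :=
  IsVertexLike K G g ∧ Nat.card {b // Linked K j G c g b} = n

/-- Elements at distance at most two of an element with `n` linked elements. -/
def NearLinks (K j n : ℕ) (G : Type*) [Group G] (c g : G) : Prop :=
  ∃ g', IsVertexLike K G g' ∧ Commute g g' ∧ ∃ g'', HasLinks K j n G c g'' ∧ Commute g' g''

/-- The formula defining the vertices of a skeleton up to the vertices outside of it. -/
def AtInner {X : Type*} {Γ : SimpleGraph X} (S : Skeleton Γ) (K j q : ℕ) (v : X) (G : Type*)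
    [Group G] (c g : G) : Prop :=
  HasLinks K j (S.deg v * q) G c g ∧ (v = S.t → NearLinks K j (S.deg S.w * q) G c g) ∧
    (v = S.t' → ¬ NearLinks K j (S.deg S.w * q) G c g)

/-- The formula defining the vertices of a graph with a skeleton. -/
def AtVertex {X : Type*} {Γ : SimpleGraph X} (S : Skeleton Γ) (K j q : ℕ) (v : X) (G : Type*)
    [Group G] (c g : G) : Prop :=
  -- For `v` in `S.I` the index type is empty and nothing is added. For the other vertices `AtInner`
  -- only says that the degree is zero, and the neighbours in `S.I` do the rest.
  AtInner S K j q v G c g ∧ ∀ a : {a // v ∉ S.I ∧ a ∈ S.I ∧ Γ.Adj v a},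
    ∃ g', AtInner S K j q a.1 G c g' ∧ Commute g g'

namespace WLInvariant

variable (K : ℕ) {j k : ℕ}

theorem hasLinks (hj : j ≤ 2 ^ k) (n : ℕ) :
    WLInvariant.{u} (7 + 2 * k) fun G _ _ c g _ _ => HasLinks K j n G c g :=
  (((isVertexLike K).perm ![1, 0, 2, 3]).mono (by omega)).and (card_linked K hj n)

theorem nearLinks (hj : j ≤ 2 ^ k) (n : ℕ) :
    WLInvariant.{u} (9 + 2 * k) fun G _ _ c g _ _ => NearLinks K j n G c g := by
  have h1 : WLInvariant.{u} (8 + 2 * k) fun G _ _ c _ _ g' =>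
      ∃ g'', HasLinks K j n G c g'' ∧ Commute g' g'' :=
    ((((hasLinks K hj n).perm ![0, 3, 1, 2]).and
      ((commute.perm ![1, 3, 0, 2]).mono (by omega))).ex.perm ![0, 3, 1, 2]).mono (by omega)
  exact ((((isVertexLike K).perm ![3, 0, 1, 2]).mono (by omega)).and
    (((commute.perm ![1, 3, 0, 2]).mono (by omega)).and h1)).ex.mono (by omega)

variable {X : Type*} {Γ : SimpleGraph X}

theorem atInner (hj : j ≤ 2 ^ k) (S : Skeleton Γ) (q : ℕ) (v : X) :
    WLInvariant.{u} (9 + 2 * k) fun G _ _ c g _ _ => AtInner S K j q v G c g :=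
  ((hasLinks K hj _).mono (by omega)).and
    ((forall_index fun _ => nearLinks K hj _).and (forall_index fun _ => (nearLinks K hj _).not))

theorem atVertex (hj : j ≤ 2 ^ k) (S : Skeleton Γ) (q : ℕ) (v : X) :
    WLInvariant.{u} (10 + 2 * k) fun G _ _ c g _ _ => AtVertex S K j q v G c g :=
  ((atInner K hj S q v).mono (by omega)).and (forall_index fun a =>
    ((((atInner K hj S q a.1).perm ![0, 3, 1, 2]).and
      ((commute.perm ![1, 3, 0, 2]).mono (by omega))).ex.mono (by omega)))

end WLInvariant

namespace MeklerModel

variable {X : Type*} [LinearOrder X] [Finite X] {p : ℕ} [Fact p.Prime] {Γ : SimpleGraph X}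

theorem hasLinks_iff (hΓ : Γ.IsNice) (S : Skeleton Γ) (v : X) (g : MeklerModel p Γ) :
    HasLinks (p ^ 2 * Nat.card (NonEdge Γ → ZMod p)) ({e : NonEdge Γ | S.Thr e.1.1 e.1.2}.ncard - 1)
      (S.deg v * Nat.card (NonEdge Γ → ZMod p)) (MeklerModel p Γ) (code p Γ S.Thr) g ↔
      ∃ u, OnLine u g ∧ S.deg u = S.deg v := by
  have hpos : 0 < Nat.card (NonEdge Γ → ZMod p) := Nat.card_pos
  rw [HasLinks, isVertexLike_iff hΓ]
  constructor
  · rintro ⟨⟨u, hu⟩, h⟩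
    rw [card_linked_code hΓ S.thr_spec hu] at h
    exact ⟨u, hu, Nat.eq_of_mul_eq_mul_right hpos h⟩
  · rintro ⟨u, hu, h⟩
    refine ⟨⟨u, hu⟩, ?_⟩
    rw [card_linked_code hΓ S.thr_spec hu, ← h]
    rfl

theorem hasLinks_w_iff (hΓ : Γ.IsNice) (S : Skeleton Γ) (g : MeklerModel p Γ) :
    HasLinks (p ^ 2 * Nat.card (NonEdge Γ → ZMod p)) ({e : NonEdge Γ | S.Thr e.1.1 e.1.2}.ncard - 1)
      (S.deg S.w * Nat.card (NonEdge Γ → ZMod p)) (MeklerModel p Γ) (code p Γ S.Thr) g ↔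
      OnLine S.w g := by
  rw [hasLinks_iff hΓ]
  constructor
  · rintro ⟨u, hu, h⟩
    rcases S.eq_or_twins S.w_mem h.symm with rfl | h | h
    · exact hu
    · exact absurd h.1 S.w_ne
    · exact absurd h.1 S.w_ne'
  · exact fun h => ⟨_, h, rfl⟩

theorem nearLinks_iff (hΓ : Γ.IsNice) (S : Skeleton Γ) {u : X} {g : MeklerModel p Γ} (hu : OnLine u g) :
    NearLinks (p ^ 2 * Nat.card (NonEdge Γ → ZMod p)) ({e : NonEdge Γ | S.Thr e.1.1 e.1.2}.ncard - 1)
      (S.deg S.w * Nat.card (NonEdge Γ → ZMod p)) (MeklerModel p Γ) (code p Γ S.Thr) g ↔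
      ∃ y, (u = y ∨ Γ.Adj u y) ∧ (y = S.w ∨ Γ.Adj y S.w) := by
  have one_ne : (1 : ZMod p) ≠ 0 := one_ne_zero
  simp only [NearLinks, hasLinks_w_iff hΓ, isVertexLike_iff hΓ]
  constructor
  · rintro ⟨g', ⟨y, hy⟩, h1, g'', hw, h2⟩
    exact ⟨y, (commute_iff_of_onLine hu hy).1 h1, (commute_iff_of_onLine hy hw).1 h2⟩
  · rintro ⟨y, h1, h2⟩
    exact ⟨gen y 1, ⟨y, onLine_gen y one_ne⟩,
      (commute_iff_of_onLine hu (onLine_gen y one_ne)).2 h1, gen S.w 1, onLine_gen _ one_ne,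
      (commute_iff_of_onLine (onLine_gen y one_ne) (onLine_gen _ one_ne)).2 h2⟩

theorem atInner_iff (hΓ : Γ.IsNice) (S : Skeleton Γ) {v : X} (hv : v ∈ S.I) (g : MeklerModel p Γ) :
    AtInner S (p ^ 2 * Nat.card (NonEdge Γ → ZMod p))
      ({e : NonEdge Γ | S.Thr e.1.1 e.1.2}.ncard - 1) (Nat.card (NonEdge Γ → ZMod p)) v
      (MeklerModel p Γ) (code p Γ S.Thr) g ↔ OnLine v g := by
  have ht : ∃ y, (S.t = y ∨ Γ.Adj S.t y) ∧ (y = S.w ∨ Γ.Adj y S.w) := by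
    obtain ⟨y, h1, h2⟩ := S.common
    exact ⟨y, Or.inr h1, Or.inr h2.symm⟩
  have ht' : ¬ ∃ y, (S.t' = y ∨ Γ.Adj S.t' y) ∧ (y = S.w ∨ Γ.Adj y S.w) := by
    rintro ⟨y, rfl | h1, h2 | h2⟩
    · exact S.w_ne' h2.symm
    · exact S.indep S.t'_mem S.w_mem h2
    · exact S.indep S.t'_mem S.w_mem (h2 ▸ h1)
    · exact S.no_common y h1 h2.symm
  rw [AtInner, hasLinks_iff hΓ]
  constructor
  · rintro ⟨⟨u, hu, hd⟩, h1, h2⟩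
    rcases S.eq_or_twins hv hd.symm with rfl | ⟨h3, rfl⟩ | ⟨h3, rfl⟩
    · exact hu
    · exact absurd ((nearLinks_iff hΓ S hu).1 (h1 h3)) ht'
    · exact absurd ((nearLinks_iff hΓ S hu).2 ht) (h2 h3)
  · intro hvg
    refine ⟨⟨v, hvg, rfl⟩, ?_, ?_⟩
    · rintro rfl
      exact (nearLinks_iff hΓ S hvg).2 ht
    · rintro rfl
      exact fun h => ht' ((nearLinks_iff hΓ S hvg).1 h)

/-- For a vertex outside `S.I`, degree zero places the line outside `S.I`, so commuting with a
skeleton vertex means adjacency. Two shared skeleton neighbours force equality, as there are no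
squares. -/
theorem atVertex_iff (hΓ : Γ.IsNice) (S : Skeleton Γ) (v : X) (g : MeklerModel p Γ) :
    AtVertex S (p ^ 2 * Nat.card (NonEdge Γ → ZMod p))
      ({e : NonEdge Γ | S.Thr e.1.1 e.1.2}.ncard - 1) (Nat.card (NonEdge Γ → ZMod p)) v
      (MeklerModel p Γ) (code p Γ S.Thr) g ↔ OnLine v g := by
  have one_ne : (1 : ZMod p) ≠ 0 := one_ne_zero
  by_cases hv : v ∈ S.I
  · rw [AtVertex, atInner_iff hΓ S hv, and_iff_left fun a => absurd hv a.2.1]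
  · have hmem : ∀ {a}, a ∈ S.I → a ≠ v := fun ha h => hv (h ▸ ha)
    constructor
    · rintro ⟨h1, h2⟩
      obtain ⟨u, hu, hd⟩ := (hasLinks_iff hΓ S v g).1 h1.1
      have huI : u ∉ S.I := fun huI => by
        have := S.deg_pos huI
        rw [hd, S.deg_of_notMem hv] at this
        exact this.false
      have key : ∀ a ∈ S.I, Γ.Adj v a → Γ.Adj u a := fun a ha hva => by
        obtain ⟨g', hg', hc⟩ := h2 ⟨a, hv, ha, hva⟩
        have := (commute_iff_of_onLine hu ((atInner_iff hΓ S ha g').1 hg')).1 hc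
        exact this.resolve_left fun h => huI (h ▸ ha)
      obtain ⟨a, ha, b, hb, hab, hva, hvb⟩ := S.two_neighbors hv
      have : u = v := by
        by_contra huv
        exact hab (hΓ.no_square huv (key a ha hva) hva (key b hb hvb) hvb)
      exact this ▸ hu
    · intro hvg
      refine ⟨⟨(hasLinks_iff hΓ S v g).2 ⟨v, hvg, rfl⟩, fun h => absurd (h ▸ S.t_mem) hv,
        fun h => absurd (h ▸ S.t'_mem) hv⟩, ?_⟩
      rintro ⟨a, -, ha, hva⟩
      exact ⟨gen a 1, (atInner_iff hΓ S ha _).2 (onLine_gen a one_ne),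
        (commute_iff_of_onLine hvg (onLine_gen a one_ne)).2 (Or.inr hva)⟩

end MeklerModel

/-! ### From the model back to Mekler's groups -/

open MeklerModel

theorem MeklerGroup.nonempty_mulEquiv_of_wlColors_eq {X : Type u} [Fintype X] {p : ℕ}
    [Fact p.Prime] {Γ : SimpleGraph X} (hΓ : Γ.IsNice) (S : Skeleton Γ) {k l R : ℕ}
    (hX : Fintype.card X + 1 ≤ 2 ^ k) (hp : p ≤ 2 ^ 2 ^ l) (hR : 3 * l + 8 * k + 16 ≤ R)
    {H : Type u} [Group H] [Fintype H]
    (h : wlColors (groupInitialColor (MeklerGroup p Γ) 3) R = wlColors (groupInitialColor H 3) R) :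
    Nonempty (MeklerGroup p Γ ≃* H) := by
  classical
  let _ : LinearOrder X := LinearOrder.lift' (Fintype.equivFin X) (Fintype.equivFin X).injective
  -- Non-edges are pairs of vertices, so their logarithm is at most `2 * k`; this doubling accounts
  -- for the coefficient 8 in `hR`.
  have hN : Nat.card (NonEdge Γ) ≤ 2 ^ (2 * k) := by
    calc Nat.card (NonEdge Γ) ≤ Nat.card (X × X) :=
          Nat.card_le_card_of_injective _ Subtype.val_injective
      _ = Fintype.card X * Fintype.card X := by simp
      _ ≤ 2 ^ k * 2 ^ k := Nat.mul_le_mul (by omega) (by omega)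
      _ = 2 ^ (2 * k) := by rw [two_mul, pow_add]
  have hj : {e : NonEdge Γ | S.Thr e.1.1 e.1.2}.ncard - 1 ≤ 2 ^ (2 * k) := by
    have := Set.ncard_le_card {e : NonEdge Γ | S.Thr e.1.1 e.1.2}
    omega
  rw [wlColors_congr (meklerEquivModel (p := p) (Γ := Γ))] at h
  obtain ⟨e⟩ := _root_.nonempty_mulEquiv_of_wlColors_eq hΓ (code p Γ S.Thr)
    (fun v => WLInvariant.atVertex _ hj S _ v) (atVertex_iff hΓ S) (k := 2 * k)
    (hX.trans (Nat.pow_le_pow_right two_pos (by omega))) hN hp (by omega) h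
  exact ⟨meklerEquivModel.trans e⟩

theorem MeklerGroup.nonempty_iso_of_mulEquiv {X : Type*} [Fintype X] {p : ℕ} [Fact p.Prime]
    {Γ Δ : SimpleGraph X} (hΓ : Γ.IsNice) (hΔ : Δ.IsNice) (e : MeklerGroup p Γ ≃* MeklerGroup p Δ) :
    Nonempty (Γ ≃g Δ) := by
  let _ : LinearOrder X := LinearOrder.lift' (Fintype.equivFin X) (Fintype.equivFin X).injective
  exact MeklerModel.nonempty_iso_of_mulEquiv hΓ hΔ
    ((meklerEquivModel.symm.trans e).trans meklerEquivModel)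

theorem MeklerGroup.pow_card_le {X : Type*} [Fintype X] (p : ℕ) [Fact p.Prime] (Γ : SimpleGraph X) :
    p ^ Fintype.card X ≤ Nat.card (MeklerGroup p Γ) := by
  let _ : LinearOrder X := LinearOrder.lift' (Fintype.equivFin X) (Fintype.equivFin X).injective
  have h : Function.Injective fun w : X → ZMod p => (⟨w, 0⟩ : MeklerModel p Γ) := fun w w' h =>
    (MeklerModel.ext_iff.1 h).1
  have := Nat.card_le_card_of_injective _ h
  rw [Nat.card_congr (meklerEquivModel (p := p) (Γ := Γ)).toEquiv]
  simpa [Nat.card_fun] using this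

/-! ### CFI graphs over cubic graphs -/

/-- Every vertex has exactly three neighbours. -/
def SimpleGraph.IsCubic {V : Type*} (Γ : SimpleGraph V) : Prop :=
  ∀ v, ∃ a b c, a ≠ b ∧ a ≠ c ∧ b ≠ c ∧ ∀ w, Γ.Adj v w ↔ w = a ∨ w = b ∨ w = c

theorem SimpleGraph.IsRegularOfDegree.isCubic {V : Type*} {Γ : SimpleGraph V} [Γ.LocallyFinite]
    (h : Γ.IsRegularOfDegree 3) : Γ.IsCubic := by
  classical
  intro v
  obtain ⟨a, b, c, hab, hac, hbc, hs⟩ := Finset.card_eq_three.1 (h v)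
  refine ⟨a, b, c, hab, hac, hbc, fun w => ?_⟩
  rw [← SimpleGraph.mem_neighborFinset, hs]
  simp

namespace SimpleGraph.IsCubic

variable {V : Type*} {Γ : SimpleGraph V}

theorem exists_third (h : Γ.IsCubic) {v x y : V} (hx : Γ.Adj v x) (hy : Γ.Adj v y) (hxy : x ≠ y) :
    ∃ z, z ≠ x ∧ z ≠ y ∧ ∀ w, Γ.Adj v w ↔ w = x ∨ w = y ∨ w = z := by
  obtain ⟨a, b, c, hab, hac, hbc, hs⟩ := h v
  have hx' := (hs x).1 hx
  have hy' := (hs y).1 hy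
  rcases hx' with rfl | rfl | rfl <;> rcases hy' with rfl | rfl | rfl <;>
    first
    | exact absurd rfl hxy
    | exact ⟨c, hac.symm, hbc.symm, fun w => by rw [hs]⟩
    | exact ⟨c, hbc.symm, hac.symm, fun w => by rw [hs]; tauto⟩
    | exact ⟨b, hab.symm, hbc, fun w => by rw [hs]; tauto⟩
    | exact ⟨b, hbc, hab.symm, fun w => by rw [hs]; tauto⟩
    | exact ⟨a, hab, hac, fun w => by rw [hs]; tauto⟩
    | exact ⟨a, hac, hab, fun w => by rw [hs]; tauto⟩

theorem exists_others (h : Γ.IsCubic) {v x : V} (hx : Γ.Adj v x) :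
    ∃ y z, y ≠ x ∧ z ≠ x ∧ y ≠ z ∧ ∀ w, Γ.Adj v w ↔ w = x ∨ w = y ∨ w = z := by
  obtain ⟨a, b, c, hab, hac, hbc, hs⟩ := h v
  have hy : ∃ y, y ≠ x ∧ Γ.Adj v y := by
    by_cases hax : a = x
    · exact ⟨b, fun h => hab (hax.trans h.symm), (hs b).2 (Or.inr (Or.inl rfl))⟩
    · exact ⟨a, hax, (hs a).2 (Or.inl rfl)⟩
  obtain ⟨y, hyx, hy⟩ := hy
  obtain ⟨z, hzx, hzy, hz⟩ := h.exists_third hx hy hyx.symm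
  exact ⟨y, z, hyx, hzx, hzy.symm, hz⟩

/-- Even sets of neighbours that agree at two neighbours are equal. -/
theorem eq_of_even (h : Γ.IsCubic) {v x y : V} {s s' : Finset V} (hs : ∀ w ∈ s, Γ.Adj v w)
    (hs' : ∀ w ∈ s', Γ.Adj v w) (he : Even s.card) (he' : Even s'.card) (hx : Γ.Adj v x)
    (hy : Γ.Adj v y) (hxy : x ≠ y) (hxs : x ∈ s ↔ x ∈ s') (hys : y ∈ s ↔ y ∈ s') : s = s' := by
  classical
  obtain ⟨z, hzx, hzy, hz⟩ := h.exists_third hx hy hxy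
  have key : ∀ {s s' : Finset V}, (∀ w ∈ s, Γ.Adj v w) → (∀ w ∈ s', Γ.Adj v w) → Even s.card →
      Even s'.card → (x ∈ s ↔ x ∈ s') → (y ∈ s ↔ y ∈ s') → z ∈ s → z ∈ s' := by
    intro s s' hs hs' he he' hxs hys hzs
    by_contra hzs'
    have hins : s = insert z s' := by
      ext w
      rw [Finset.mem_insert]
      constructor
      · intro hw
        rcases (hz w).1 (hs w hw) with rfl | rfl | rfl
        · exact Or.inr (hxs.1 hw)
        · exact Or.inr (hys.1 hw)
        · exact Or.inl rfl
      · rintro (rfl | hw)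
        · exact hzs
        · rcases (hz w).1 (hs' w hw) with rfl | rfl | rfl
          · exact hxs.2 hw
          · exact hys.2 hw
          · exact absurd hw hzs'
    rw [hins, Finset.card_insert_of_notMem hzs'] at he
    exact (Nat.even_add_one.1 he) he'
  have hzs : z ∈ s ↔ z ∈ s' := ⟨key hs hs' he he' hxs hys, key hs' hs he' he hxs.symm hys.symm⟩
  ext w
  by_cases hw : Γ.Adj v w
  · rcases (hz w).1 hw with rfl | rfl | rfl
    exacts [hxs, hys, hzs]
  · exact ⟨fun h => absurd (hs w h) hw, fun h => absurd (hs' w h) hw⟩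

/-- Two even sets of neighbours agree at some neighbour. -/
theorem exists_agree (h : Γ.IsCubic) {v : V} {s s' : Finset V} (hs : ∀ w ∈ s, Γ.Adj v w)
    (hs' : ∀ w ∈ s', Γ.Adj v w) (he : Even s.card) (he' : Even s'.card) :
    ∃ x, Γ.Adj v x ∧ (x ∈ s ↔ x ∈ s') := by
  classical
  by_contra! hcon
  obtain ⟨a, b, c, hab, hac, hbc, hn⟩ := h v
  have hdis : Disjoint s s' := Finset.disjoint_left.2 fun w hw hw' => by
    have := hcon w (hs w hw)
    tauto
  have hun : s ∪ s' = {a, b, c} := by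
    ext w
    simp only [Finset.mem_union, Finset.mem_insert, Finset.mem_singleton]
    rw [← hn]
    constructor
    · rintro (hw | hw)
      exacts [hs w hw, hs' w hw]
    · intro hw
      have := hcon w hw
      tauto
  have hcard := congrArg Finset.card hun
  rw [Finset.card_union_of_disjoint hdis, Finset.card_eq_three.2 ⟨a, b, c, hab, hac, hbc, rfl⟩]
    at hcard
  have := he.add he'
  rw [hcard] at this
  exact absurd this (by decide)

end SimpleGraph.IsCubic

/-- The internal vertices of CFI graphs. -/
abbrev CFIInner {V : Type*} (Γ : SimpleGraph V) : Type _ :=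
  {x : V × Finset V // (∀ w ∈ x.2, Γ.Adj x.1 w) ∧ Even x.2.card}

/-! ### Short cycles and skeletons in CFI graphs -/

section CFI

variable {V : Type*} {Γ : SimpleGraph V} {T : Set (Sym2 V)}

theorem CFIInner.eq_of_agree (h : Γ.IsCubic) {m m' : CFIInner Γ} (hm : m.1.1 = m'.1.1) {x y : V}
    (hx : Γ.Adj m.1.1 x) (hy : Γ.Adj m.1.1 y) (hxy : x ≠ y) (hxs : x ∈ m.1.2 ↔ x ∈ m'.1.2)
    (hys : y ∈ m.1.2 ↔ y ∈ m'.1.2) : m = m' :=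
  Subtype.ext (Prod.ext hm (h.eq_of_even m.2.1 (hm ▸ m'.2.1) m.2.2 m'.2.2 hx hy hxy hxs hys))

theorem ext_external {o o' : Γ.Dart × Bool} (h1 : o.1 = o'.1) (h2 : o.2 = true ↔ o'.2 = true) :
    o = o' := Prod.ext h1 (Bool.eq_iff_iff.2 h2)

/-- An external vertex has at most one external neighbour. -/
theorem cfiTwist_external_unique {o a b : Γ.Dart × Bool} (ha : (cfiTwist Γ T).Adj (.inl o) (.inl a))
    (hb : (cfiTwist Γ T).Adj (.inl o) (.inl b)) : a = b := by
  obtain ⟨ha1, ha2⟩ := ha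
  obtain ⟨hb1, hb2⟩ := hb
  refine Prod.ext (ha1.trans hb1.symm) ?_
  have := ha2.trans hb2.symm
  revert this
  cases o.2 <;> cases a.2 <;> cases b.2 <;> simp

/-- The external neighbours of an internal vertex are determined by their darts. -/
theorem cfiInner_unique {m : CFIInner Γ} {o o' : Γ.Dart × Bool} (h : cfiInner Γ m o)
    (h' : cfiInner Γ m o') (ho : o.1 = o'.1) : o = o' :=
  ext_external ho (by rw [h.2, h'.2, ho])

theorem dart_eq {d d' : Γ.Dart} (h1 : d.fst = d'.fst) (h2 : d.snd = d'.snd) : d = d' :=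
  SimpleGraph.Dart.ext _ _ (Prod.ext h1 h2)

/-- Adjacent external vertices belong to different gadgets, so no internal vertex is adjacent to
both; the other cases fail because external neighbours of external vertices are unique and internal
vertices are independent. -/
theorem cfiTwist_no_triangle {x y z : CFIVertex Γ} (hxy : (cfiTwist Γ T).Adj x y)
    (hyz : (cfiTwist Γ T).Adj y z) : ¬ (cfiTwist Γ T).Adj x z := by
  intro hxz
  have key : ∀ {o o' : Γ.Dart × Bool} {m : CFIInner Γ}, (cfiTwist Γ T).Adj (.inl o) (.inl o') →
      cfiInner Γ m o → cfiInner Γ m o' → False := by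
    intro o o' m h h1 h2
    have h3 : o'.1.fst = o.1.snd := by rw [h.1]; rfl
    exact o.1.adj.ne ((h1.1.trans h2.1.symm).trans h3)
  rcases x with o | m <;> rcases y with o' | m' <;> rcases z with o'' | m''
  · have h1 := cfiTwist_external_unique hxy hxz
    subst h1
    exact (cfiTwist Γ T).irrefl hyz
  · exact key hxy hxz hyz
  · exact key hxz hxy hyz
  · exact hyz
  · exact key hyz hxy hxz
  · exact hxz
  · exact hxy
  · exact hxy

/-- Sharing two external neighbours means agreeing at two of the three bits, and parity determines
the third. -/
theorem cfiTwist_no_square_aux (hΓ : Γ.IsCubic) {m m' : CFIInner Γ} {o o' : Γ.Dart × Bool}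
    (h1 : cfiInner Γ m o) (h2 : cfiInner Γ m' o) (h3 : cfiInner Γ m o') (h4 : cfiInner Γ m' o') :
    m = m' ∨ o = o' := by
  by_cases ho : o.1 = o'.1
  · exact Or.inr (cfiInner_unique h1 h3 ho)
  · left
    have hne : o.1.snd ≠ o'.1.snd := fun h => ho (dart_eq (h1.1.trans h3.1.symm) h)
    refine CFIInner.eq_of_agree hΓ (h1.1.symm.trans h2.1) (x := o.1.snd) (y := o'.1.snd) ?_ ?_ hne
      (h1.2.symm.trans h2.2) (h3.2.symm.trans h4.2)
    · rw [← h1.1]; exact o.1.adj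
    · rw [← h3.1]; exact o'.1.adj

theorem cfiTwist_no_square (hΓ : Γ.IsCubic) {x y a b : CFIVertex Γ} (hxy : x ≠ y)
    (hxa : (cfiTwist Γ T).Adj x a) (hya : (cfiTwist Γ T).Adj y a) (hxb : (cfiTwist Γ T).Adj x b)
    (hyb : (cfiTwist Γ T).Adj y b) : a = b := by
  have hext : ∀ {o o' c : Γ.Dart × Bool}, (cfiTwist Γ T).Adj (.inl o) (.inl c) →
      (cfiTwist Γ T).Adj (.inl o') (.inl c) → o = o' := fun h h' =>
    cfiTwist_external_unique h.symm h'.symm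
  rcases x with o | m <;> rcases y with o' | m' <;> rcases a with a | n <;> rcases b with b | n'
  · exact absurd (congrArg _ (hext hxa hya)) hxy
  · exact absurd (congrArg _ (hext hxa hya)) hxy
  · exact absurd (congrArg _ (hext hxb hyb)) hxy
  · rcases cfiTwist_no_square_aux hΓ hxa hxb hya hyb with h | h
    · exact congrArg _ h
    · exact absurd (congrArg _ h) hxy
  · exact congrArg _ (cfiTwist_external_unique hxa hxb)
  · exact hyb.elim
  · exact hya.elim
  · exact hya.elim
  · exact congrArg _ (cfiTwist_external_unique hya hyb)
  · exact hxb.elim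
  · exact hxa.elim
  · exact hxa.elim
  · rcases cfiTwist_no_square_aux hΓ hxa hya hxb hyb with h | h
    · exact absurd (congrArg _ h) hxy
    · exact congrArg _ h
  · exact hxb.elim
  · exact hxa.elim
  · exact hxa.elim

theorem exists_two_internal (hΓ : Γ.IsCubic) (o : Γ.Dart × Bool) :
    ∃ m m' : CFIInner Γ, m ≠ m' ∧ cfiInner Γ m o ∧ cfiInner Γ m' o := by
  classical
  obtain ⟨d, b⟩ := o
  obtain ⟨y, z, hy, hz, hyz, hn⟩ := hΓ.exists_others d.adj
  have hay : Γ.Adj d.fst y := (hn y).2 (Or.inr (Or.inl rfl))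
  have haz : Γ.Adj d.fst z := (hn z).2 (Or.inr (Or.inr rfl))
  cases b
  · refine ⟨⟨(d.fst, ∅), by simp, by simp⟩, ⟨(d.fst, {y, z}), by simp [hay, haz],
      by simp [Finset.card_pair hyz]⟩, fun h => ?_, ⟨rfl, by simp⟩, ⟨rfl, by simp [hy.symm, hz.symm]⟩⟩
    have := congrArg (fun m => m.1.2.card) h
    simp [Finset.card_pair hyz] at this
  · refine ⟨⟨(d.fst, {d.snd, y}), by simp [hay, d.adj], by simp [Finset.card_pair hy.symm]⟩,
      ⟨(d.fst, {d.snd, z}), by simp [haz, d.adj], by simp [Finset.card_pair hz.symm]⟩, fun h => ?_,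
      ⟨rfl, by simp⟩, ⟨rfl, by simp⟩⟩
    have h1 : y ∈ ({d.snd, z} : Finset V) := by
      have := congrArg (fun m => m.1.2) h
      simp only at this
      rw [← this]
      simp
    simp [hy, hyz] at h1

theorem cfiTwist_isNice (hΓ : Γ.IsCubic) (T : Set (Sym2 V)) : (cfiTwist Γ T).IsNice where
  no_triangle := cfiTwist_no_triangle
  no_square := cfiTwist_no_square hΓ
  two_neighbors := by
    classical
    rintro (o | m)
    · obtain ⟨m, m', hne, h1, h2⟩ := exists_two_internal hΓ o
      exact ⟨.inr m, .inr m', fun h => hne (Sum.inr_injective h), h1, h2⟩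
    · obtain ⟨a, b, c, hab, -, -, hn⟩ := hΓ m.1.1
      have ha : Γ.Adj m.1.1 a := (hn a).2 (Or.inl rfl)
      have hb : Γ.Adj m.1.1 b := (hn b).2 (Or.inr (Or.inl rfl))
      refine ⟨.inl (⟨(m.1.1, a), ha⟩, decide (a ∈ m.1.2)), .inl (⟨(m.1.1, b), hb⟩, decide (b ∈ m.1.2)),
        fun h => hab ?_, ⟨rfl, by simp⟩, ⟨rfl, by simp⟩⟩
      have := congrArg (fun o => o.1.snd) (Sum.inl_injective h)
      exact this

theorem exists_enumeration {X : Type*} (I : Finset X) {t t' : X} (ht : t ∈ I) (ht' : t' ∈ I)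
    (hne : t ≠ t') : ∃ pos : X → ℕ, (∀ u ∈ I, pos u < I.card) ∧
      (∀ u ∈ I, ∀ v ∈ I, pos u = pos v → u = v) ∧ pos t + 1 = I.card / 2 ∧
      pos t' = I.card / 2 := by
  classical
  have hcard : 1 < I.card := Finset.one_lt_card.2 ⟨t, ht, t', ht', hne⟩
  let a : Fin I.card := ⟨I.card / 2 - 1, by omega⟩
  let b : Fin I.card := ⟨I.card / 2, by omega⟩
  have hab : a ≠ b := fun h => by
    have := congrArg Fin.val h
    simp only [a, b] at this
    omega
  let e₀ : I ≃ Fin I.card := I.equivFin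
  let e₁ := e₀.trans (Equiv.swap (e₀ ⟨t, ht⟩) a)
  -- The second transposition does not undo the first, since `a` is neither of the two values it
  -- exchanges.
  let e₂ := e₁.trans (Equiv.swap (e₁ ⟨t', ht'⟩) b)
  have h1 : e₁ ⟨t, ht⟩ = a := by simp [e₁]
  have h2 : e₂ ⟨t', ht'⟩ = b := by simp [e₂]
  have h3 : e₂ ⟨t, ht⟩ = a := by
    have h4 : e₁ ⟨t, ht⟩ ≠ e₁ ⟨t', ht'⟩ := fun h => hne (Subtype.ext_iff.1 (e₁.injective h))
    rw [h1] at h4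
    change Equiv.swap (e₁ ⟨t', ht'⟩) b (e₁ ⟨t, ht⟩) = a
    rw [h1, Equiv.swap_apply_of_ne_of_ne h4 hab]
  refine ⟨fun u => if h : u ∈ I then (e₂ ⟨u, h⟩).val else 0, fun u hu => ?_,
    fun u hu v hv h => ?_, ?_, ?_⟩
  · simp [hu]
  · simp only [hu, hv, dif_pos] at h
    exact Subtype.ext_iff.1 (e₂.injective (Fin.ext h))
  · simp only [ht, dif_pos, h3, a]
    omega
  · simp only [ht', dif_pos, h2, b]

/-- The skeleton of a CFI graph consisting of its internal vertices. -/
theorem nonempty_skeleton [Finite V] (hΓ : Γ.IsCubic) (T : Set (Sym2 V)) {v v' : V} (hv : v ≠ v') :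
    Nonempty (Skeleton (cfiTwist Γ T)) := by
  classical
  have := Fintype.ofFinite (CFIVertex Γ)
  let I : Finset (CFIVertex Γ) := Finset.univ.filter fun x => x.isRight
  have hI : ∀ m : CFIInner Γ, (.inr m : CFIVertex Γ) ∈ I := fun m => by simp [I]
  have hI' : ∀ {x : CFIVertex Γ}, x ∈ I → ∃ m, x = .inr m := fun {x} hx => by
    rcases x with o | m
    · simp [I] at hx
    · exact ⟨m, rfl⟩
  obtain ⟨a, b, c, hab, hac, hbc, hn⟩ := hΓ v
  have ha : Γ.Adj v a := (hn a).2 (Or.inl rfl)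
  have hb : Γ.Adj v b := (hn b).2 (Or.inr (Or.inl rfl))
  have hc : Γ.Adj v c := (hn c).2 (Or.inr (Or.inr rfl))
  -- The strings of `t` and `w` agree at `c`, which gives a common neighbour. The vertex `t'` lies
  -- in another gadget and shares no neighbour with `w`.
  let t : CFIInner Γ := ⟨(v, ∅), by simp, by simp⟩
  let t' : CFIInner Γ := ⟨(v', ∅), by simp, by simp⟩
  let w : CFIInner Γ := ⟨(v, {a, b}), by simp [ha, hb], by simp [Finset.card_pair hab]⟩
  have htt' : (.inr t : CFIVertex Γ) ≠ .inr t' := fun h =>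
    hv (congrArg (fun m => m.1.1) (Sum.inr_injective h))
  obtain ⟨pos, h1, h2, h3, h4⟩ := exists_enumeration I (hI t) (hI t') htt'
  exact ⟨{
    I := I
    pos := pos
    t := .inr t
    t' := .inr t'
    w := .inr w
    indep := fun {x y} hx hy h => by
      obtain ⟨m, rfl⟩ := hI' hx
      obtain ⟨m', rfl⟩ := hI' hy
      exact h
    two_neighbors := fun {x} hx => by
      rcases x with o | m
      · obtain ⟨m, m', hne, h1, h2⟩ := exists_two_internal hΓ o
        exact ⟨.inr m, hI m, .inr m', hI m', fun h => hne (Sum.inr_injective h), h1, h2⟩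
      · exact absurd (hI m) hx
    pos_lt := fun hu => h1 _ hu
    pos_inj := fun hu hv => h2 _ hu _ hv
    t_mem := hI t
    t'_mem := hI t'
    w_mem := hI w
    w_ne := fun h => by
      have := congrArg (fun m => m.1.2.card) (Sum.inr_injective h)
      simp [w, t, Finset.card_pair hab] at this
    w_ne' := fun h => hv (congrArg (fun m => m.1.1) (Sum.inr_injective h))
    pos_t := h3
    pos_t' := h4
    common := ⟨.inl (⟨(v, c), hc⟩, false), ⟨rfl, by simp [t]⟩,
      ⟨rfl, by simp [w, hac.symm, hbc.symm]⟩⟩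
    no_common := fun y hy hy' => by
      rcases y with o | m
      · exact hv (hy'.1.symm.trans hy.1)
      · exact hy }⟩

end CFI

/-! ### The twisted CFI graph is not isomorphic to the untwisted one -/

/-- There are no even sets of neighbours that are inconsistent at exactly one edge. -/
theorem false_of_even_of_single_twist {V : Type*} [Finite V] {Γ : SimpleGraph V}
    (B : V → Finset V) (hB : ∀ u, ∀ v ∈ B u, Γ.Adj u v) (heven : ∀ u, Even (B u).card) {e : Sym2 V}
    (he : e ∈ Γ.edgeSet) (h : ∀ u v, Γ.Adj u v → (¬ (v ∈ B u ↔ u ∈ B v) ↔ s(u, v) = e)) :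
    False := by
  classical
  have := Fintype.ofFinite V
  induction e using Sym2.ind with
  | _ a b =>
  have hab : Γ.Adj a b := he
  let f : V × V → ZMod 2 := fun x => if x.2 ∈ B x.1 then 1 else 0
  -- Overwriting `f` at the single pair `(a, b)` makes it symmetric, so its sum cancels under
  -- `Prod.swap`. The sum of `f` vanishes by evenness, and comparing the two gives consistency at
  -- the exceptional edge.
  let g : V × V → ZMod 2 := fun x => if x = (a, b) then f (b, a) else f x
  have hf : ∑ x, f x = 0 := by
    rw [Fintype.sum_prod_type]
    refine Finset.sum_eq_zero fun u _ => ?_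
    simp only [f, Finset.sum_boole]
    rw [ZMod.natCast_eq_zero_iff_even]
    simpa using heven u
  have hfsymm : ∀ u v, s(u, v) ≠ s(a, b) → f (u, v) = f (v, u) := by
    intro u v huv
    by_cases hadj : Γ.Adj u v
    · have : v ∈ B u ↔ u ∈ B v := not_not.1 (mt (h u v hadj).1 huv)
      simp [f, this]
    · have h1 : v ∉ B u := fun h => hadj (hB u v h)
      have h2 : u ∉ B v := fun h => hadj (hB v u h).symm
      simp [f, h1, h2]
  have hgsymm : ∀ x : V × V, g x = g x.swap := by
    rintro ⟨u, v⟩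
    by_cases h1 : (u, v) = (a, b)
    · obtain ⟨rfl, rfl⟩ := Prod.ext_iff.1 h1
      simp [g]
    · by_cases h2 : (v, u) = (a, b)
      · obtain ⟨rfl, rfl⟩ := Prod.ext_iff.1 h2
        simp [g]
      · have : s(u, v) ≠ s(a, b) := by
          rw [Ne, Sym2.eq_iff]
          rintro (⟨rfl, rfl⟩ | ⟨rfl, rfl⟩)
          · exact h1 rfl
          · exact h2 rfl
        simp only [g, Prod.swap_prod_mk, if_neg h1, if_neg h2]
        exact hfsymm u v this
  have hg : ∑ x, g x = 0 := by
    refine Finset.sum_involution (fun x _ => x.swap) (fun x _ => ?_) (fun x _ hx hswap => hx ?_)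
      (fun _ _ => Finset.mem_univ _) (fun x _ => x.swap_swap)
    · rw [← hgsymm]
      exact CharTwo.add_self_eq_zero _
    · obtain ⟨u, v⟩ := x
      have huv : v = u := (Prod.ext_iff.1 hswap).1
      subst huv
      have h1 : (v, v) ≠ (a, b) := fun h => hab.ne
        ((Prod.ext_iff.1 h).1.symm.trans (Prod.ext_iff.1 h).2)
      have h2 : v ∉ B v := fun h => (hB v v h).ne rfl
      simp [g, h1, f, h2]
  have hdiff : ∑ x, (f x - g x) = f (a, b) - f (b, a) := by
    rw [Finset.sum_eq_single (a, b)]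
    · simp [g]
    · intro x _ hx
      simp [g, hx]
    · simp
  rw [Finset.sum_sub_distrib, hf, hg, sub_zero] at hdiff
  have hne := (h a b hab).2 rfl
  apply hne
  have h3 := sub_eq_zero.1 hdiff.symm
  by_cases h1 : b ∈ B a <;> by_cases h2 : a ∈ B b <;> simp [f, h1, h2] at h3 ⊢

section CFI

variable {V : Type*} {Γ : SimpleGraph V} {T : Set (Sym2 V)}

/-- Two vertices have a common neighbour. -/
def HasCommon {X : Type*} (Γ : SimpleGraph X) (x y : X) : Prop := ∃ z, Γ.Adj x z ∧ Γ.Adj y z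

theorem HasCommon.map {X Y : Type*} {Γ : SimpleGraph X} {Δ : SimpleGraph Y} (ψ : Γ ≃g Δ) {x y : X}
    (h : HasCommon Γ x y) : HasCommon Δ (ψ x) (ψ y) := by
  obtain ⟨z, h1, h2⟩ := h
  exact ⟨ψ z, ψ.map_adj_iff.2 h1, ψ.map_adj_iff.2 h2⟩

theorem hasCommon_inr_inr_iff (hΓ : Γ.IsCubic) {m m' : CFIInner Γ} :
    HasCommon (cfiTwist Γ T) (.inr m) (.inr m') ↔ m.1.1 = m'.1.1 := by
  classical
  constructor
  · rintro ⟨o | m'', h1, h2⟩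
    · exact h1.1.symm.trans h2.1
    · exact h1.elim
  · intro h
    obtain ⟨x, hx, hiff⟩ := hΓ.exists_agree m.2.1 (h ▸ m'.2.1) m.2.2 m'.2.2
    exact ⟨.inl (⟨(m.1.1, x), hx⟩, decide (x ∈ m.1.2)), ⟨rfl, by simp⟩, ⟨h, by simp [hiff]⟩⟩

theorem hasCommon_inl_inl {o o' : Γ.Dart × Bool} (hne : o ≠ o')
    (h : HasCommon (cfiTwist Γ T) (.inl o) (.inl o')) : o'.1.fst = o.1.fst ∧ o'.1 ≠ o.1 := by
  obtain ⟨a | m, h1, h2⟩ := h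
  · exact absurd (cfiTwist_external_unique h1.symm h2.symm) hne
  · exact ⟨h2.1.trans h1.1.symm, fun ho => hne (cfiInner_unique h1 h2 ho.symm)⟩

theorem hasCommon_inl_inr {o : Γ.Dart × Bool} {m : CFIInner Γ}
    (h : HasCommon (cfiTwist Γ T) (.inl o) (.inr m)) :
    ∃ a : Γ.Dart × Bool, (cfiTwist Γ T).Adj (.inl o) (.inl a) ∧ cfiInner Γ m a := by
  obtain ⟨a | m, h1, h2⟩ := h
  · exact ⟨a, h1, h2⟩
  · exact h2.elim

theorem fst_eq_of_hasCommon_inl_inr {o : Γ.Dart × Bool} {m : CFIInner Γ}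
    (h : HasCommon (cfiTwist Γ T) (.inl o) (.inr m)) : m.1.1 = o.1.snd := by
  obtain ⟨a, h1, h2⟩ := hasCommon_inl_inr h
  rw [← h2.1, h1.1]
  rfl

/-- An external vertex is not one of four vertices any two of which have a common neighbour. -/
theorem false_of_four_hasCommon (hΓ : Γ.IsCubic) {o : Γ.Dart × Bool} {y : Fin 3 → CFIVertex Γ}
    (hy : Function.Injective y) (hne : ∀ i, .inl o ≠ y i)
    (h : ∀ i, HasCommon (cfiTwist Γ T) (.inl o) (y i))
    (h' : ∀ i j, i ≠ j → HasCommon (cfiTwist Γ T) (y i) (y j)) : False := by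
  -- Two distinct external vertices share a neighbour only inside one gadget, whereas an internal
  -- vertex sharing a neighbour with an external one lies in the gadget across its edge. Here it
  -- would lie across two different edges.
  have hmixed : ∀ i j, ∀ o' m, y i = .inl o' → y j = .inr m → False := by
    intro i j o' m hi hj
    have h1 := hasCommon_inl_inl (fun h => hne i (by rw [hi, h])) (hi ▸ h i)
    have h2 := fst_eq_of_hasCommon_inl_inr (hj ▸ h j)
    have hij : i ≠ j := fun hij => by
      rw [hij, hj] at hi
      exact Sum.inr_ne_inl hi
    have h3 := fst_eq_of_hasCommon_inl_inr (hi ▸ hj ▸ h' i j hij)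
    exact h1.2 (dart_eq h1.1 (h3.symm.trans h2))
  rcases h0 : y 0 with o₀ | m₀
  · have hall : ∀ i, ∃ o', y i = .inl o' := fun i => by
      rcases hi : y i with o' | m
      · exact ⟨o', rfl⟩
      · exact (hmixed 0 i o₀ m h0 hi).elim
    choose q hq using hall
    have hq1 : ∀ i, (q i).1.fst = o.1.fst ∧ (q i).1 ≠ o.1 := fun i =>
      hasCommon_inl_inl (fun h => hne i (by rw [hq i, h])) (hq i ▸ h i)
    have hq2 : ∀ i j, i ≠ j → (q i).1.snd ≠ (q j).1.snd := fun i j hij hs => by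
      have hc := h' i j hij
      rw [hq i, hq j] at hc
      refine (hasCommon_inl_inl (fun h => hij (hy ?_)) hc).2
        (dart_eq ((hq1 j).1.trans (hq1 i).1.symm) hs.symm)
      rw [hq i, hq j, h]
    have hq3 : ∀ i, (q i).1.snd ≠ o.1.snd := fun i hs => (hq1 i).2 (dart_eq (hq1 i).1 hs)
    have hadj : ∀ i, Γ.Adj o.1.fst (q i).1.snd := fun i => by
      rw [← (hq1 i).1]
      exact (q i).1.adj
    -- Four different darts would start at a vertex of degree three.
    obtain ⟨z, -, -, hz⟩ := hΓ.exists_third (hadj 0) (hadj 1) (hq2 0 1 (by decide))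
    have e2 := ((hz _).1 (hadj 2)).resolve_left (hq2 2 0 (by decide))
    have e2 := e2.resolve_left (hq2 2 1 (by decide))
    have e3 := ((hz _).1 o.1.adj).resolve_left (hq3 0).symm
    have e3 := e3.resolve_left (hq3 1).symm
    exact hq3 2 (e2.trans e3.symm)
  · have hall : ∀ i, ∃ m, y i = .inr m := fun i => by
      rcases hi : y i with o' | m
      · exact (hmixed i 0 o' m₀ hi h0).elim
      · exact ⟨m, rfl⟩
    choose q hq using hall
    have hq1 : ∀ i, (q i).1.1 = o.1.snd := fun i => fst_eq_of_hasCommon_inl_inr (hq i ▸ h i)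
    have hq2 : ∀ i j, (o.1.fst ∈ (q i).1.2 ↔ o.1.fst ∈ (q j).1.2) := fun i j => by
      obtain ⟨a, ha, ha'⟩ := hasCommon_inl_inr (hq i ▸ h i)
      obtain ⟨b, hb, hb'⟩ := hasCommon_inl_inr (hq j ▸ h j)
      have hab := cfiTwist_external_unique ha hb
      subst hab
      have := ha'.2.symm.trans hb'.2
      rw [ha.1] at this
      exact this
    -- All three strings agree at `o.1.fst`, so by parity the bit at `x` determines each of them,
    -- and three strings cannot be separated by one bit.
    obtain ⟨x, z, hx, -, -, hn⟩ := hΓ.exists_others o.1.adj.symm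
    have hadj : Γ.Adj o.1.snd x := (hn x).2 (Or.inr (Or.inl rfl))
    have key : ∀ i j, i ≠ j → ¬ (x ∈ (q i).1.2 ↔ x ∈ (q j).1.2) := fun i j hij hs => by
      refine hij (hy ?_)
      rw [hq i, hq j, CFIInner.eq_of_agree hΓ ((hq1 i).trans (hq1 j).symm) (hq1 i ▸ o.1.adj.symm)
        (hq1 i ▸ hadj) hx.symm (hq2 i j) hs]
    have h01 := key 0 1 (by decide)
    have h02 := key 0 2 (by decide)
    have h12 := key 1 2 (by decide)
    tauto

/-- The four internal vertices of a gadget pairwise have common neighbours. Isomorphisms preserve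
this, and no external vertex belongs to such a quadruple. -/
theorem exists_internal_of_iso (hΓ : Γ.IsCubic) {T' : Set (Sym2 V)}
    (ψ : cfiTwist Γ T ≃g cfiTwist Γ T') (v : V) :
    ∃ m : CFIInner Γ, ψ (.inr ⟨(v, ∅), by simp, by simp⟩) = .inr m := by
  classical
  obtain ⟨a, b, c, hab, hac, hbc, hn⟩ := hΓ v
  have ha : Γ.Adj v a := (hn a).2 (Or.inl rfl)
  have hb : Γ.Adj v b := (hn b).2 (Or.inr (Or.inl rfl))
  have hc : Γ.Adj v c := (hn c).2 (Or.inr (Or.inr rfl))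
  let q : Fin 3 → CFIInner Γ := ![⟨(v, {a, b}), by simp [ha, hb], by simp [Finset.card_pair hab]⟩,
    ⟨(v, {a, c}), by simp [ha, hc], by simp [Finset.card_pair hac]⟩,
    ⟨(v, {b, c}), by simp [hb, hc], by simp [Finset.card_pair hbc]⟩]
  have hq : ∀ i, (q i).1.1 = v := fun i => by fin_cases i <;> rfl
  have hq2 : ∀ i, (q i).1.2.card = 2 := fun i => by
    fin_cases i
    exacts [Finset.card_pair hab, Finset.card_pair hac, Finset.card_pair hbc]
  have hqinj : Function.Injective q := by
    intro i j hij
    have h1 : ∀ x, x ∈ (q i).1.2 ↔ x ∈ (q j).1.2 := fun x => by rw [hij]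
    have ha := h1 a
    have hb := h1 b
    have hc := h1 c
    fin_cases i <;> fin_cases j <;>
      simp [q, hab, hac, hbc, hab.symm, hac.symm, hbc.symm] at ha hb hc ⊢
  rcases hψ : ψ (.inr ⟨(v, ∅), by simp, by simp⟩) with o | m
  · exfalso
    refine false_of_four_hasCommon (T := T') hΓ (o := o) (y := fun i => ψ (.inr (q i)))
      (fun i j hij => hqinj (Sum.inr_injective (ψ.injective hij))) (fun i h => ?_) (fun i => ?_)
      (fun i j _ => HasCommon.map ψ ((hasCommon_inr_inr_iff hΓ).2 ((hq i).trans (hq j).symm)))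
    · rw [← hψ] at h
      have := congrArg (fun m => m.1.2.card) (Sum.inr_injective (ψ.injective h))
      simp [hq2] at this
    · rw [← hψ]
      exact HasCommon.map ψ ((hasCommon_inr_inr_iff hΓ).2 (hq i).symm)
  · exact ⟨m, rfl⟩

/-- An isomorphism sends the all-zero internal vertices to internal vertices, one in each gadget.
Their strings would be even and inconsistent exactly at the twisted edge, against
`false_of_even_of_single_twist`. -/
theorem isEmpty_cfi_iso_twistedCfi [Finite V] (hΓ : Γ.IsCubic) {e : Sym2 V} (he : e ∈ Γ.edgeSet) :
    IsEmpty (cfi Γ ≃g twistedCfi Γ e) := by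
  classical
  refine ⟨fun ψ => ?_⟩
  change cfiTwist Γ ∅ ≃g cfiTwist Γ {e} at ψ
  choose M hM using exists_internal_of_iso hΓ ψ
  let π : V → V := fun v => (M v).1.1
  have hπinj : Function.Injective π := by
    intro v v' h
    have h1 := (hasCommon_inr_inr_iff (T := {e}) hΓ).2 h
    rw [← hM, ← hM] at h1
    have h2 := HasCommon.map ψ.symm h1
    simp only [RelIso.symm_apply_apply] at h2
    exact (hasCommon_inr_inr_iff hΓ).1 h2
  -- The path of length three between the all-zero vertices of the gadgets at `v` and `w` is mapped
  -- to a path whose middle edge joins external vertices; that edge compares the bits of `M v` and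
  -- `M w`.
  have hedge : ∀ v w, Γ.Adj v w → Γ.Adj (π v) (π w) ∧
      (¬ (π w ∈ (M v).1.2 ↔ π v ∈ (M w).1.2) ↔ s(π v, π w) = e) := by
    intro v w hvw
    have h1 : (cfiTwist Γ ∅).Adj (.inr ⟨(v, ∅), by simp, by simp⟩)
        (.inl (⟨(v, w), hvw⟩, false)) := ⟨rfl, by simp⟩
    have h2 : (cfiTwist Γ ∅).Adj (.inl (⟨(v, w), hvw⟩, false))
        (.inl (⟨(w, v), hvw.symm⟩, false)) := ⟨rfl, by simp⟩
    have h3 : (cfiTwist Γ ∅).Adj (.inr ⟨(w, ∅), by simp, by simp⟩)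
        (.inl (⟨(w, v), hvw.symm⟩, false)) := ⟨rfl, by simp⟩
    replace h1 := ψ.map_adj_iff.2 h1
    replace h2 := ψ.map_adj_iff.2 h2
    replace h3 := ψ.map_adj_iff.2 h3
    rw [hM] at h1 h3
    rcases hx : ψ (.inl (⟨(v, w), hvw⟩, false)) with o | m
    · rcases hy : ψ (.inl (⟨(w, v), hvw.symm⟩, false)) with o' | m
      · rw [hx] at h1 h2
        rw [hy] at h2 h3
        obtain ⟨h1a, h1b⟩ := h1
        obtain ⟨h2a, h2b⟩ := h2
        obtain ⟨h3a, h3b⟩ := h3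
        have hsnd : o.1.snd = π w := by
          rw [show π w = o'.1.fst from h3a.symm, h2a]; rfl
        have hsnd' : o'.1.snd = π v := by
          rw [show π v = o.1.fst from h1a.symm, h2a]; rfl
        have hadj : Γ.Adj (π v) (π w) := by
          have := o.1.adj
          rwa [h1a, hsnd] at this
        refine ⟨hadj, ?_⟩
        have hed : o.1.edge = s(π v, π w) := by
          rw [← hsnd, show π v = o.1.fst from h1a.symm]
          rfl
        rw [hed, Set.mem_singleton_iff] at h2b
        rw [← h2b, ← hsnd, ← hsnd', ← h1b, ← h3b]
        cases o.2 <;> cases o'.2 <;> simp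
      · rw [hy] at h3
        exact h3.elim
    · rw [hx] at h1
      exact h1.elim
  -- The induced map on darts is injective and hence, by finiteness, surjective, so every base edge
  -- is covered by `hedge`.
  let δ : Γ.Dart → Γ.Dart := fun d => ⟨(π d.fst, π d.snd), (hedge _ _ d.adj).1⟩
  have hδ : Function.Surjective δ := by
    have : Finite Γ.Dart := Finite.of_injective _ SimpleGraph.Dart.toProd_injective
    refine Finite.surjective_of_injective fun d d' h => ?_
    have h1 : π d.fst = π d'.fst := congrArg (fun d : Γ.Dart => d.fst) h
    have h2 : π d.snd = π d'.snd := congrArg (fun d : Γ.Dart => d.snd) h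
    exact dart_eq (hπinj h1) (hπinj h2)
  let ρ := Equiv.ofBijective π (Finite.injective_iff_bijective.1 hπinj)
  have hρ : ∀ v, ρ.symm (π v) = v := fun v => ρ.symm_apply_apply v
  have hρ' : ∀ u, (M (ρ.symm u)).1.1 = u := fun u => ρ.apply_symm_apply u
  refine false_of_even_of_single_twist (fun u => (M (ρ.symm u)).1.2) (fun u v hv => ?_)
    (fun u => (M (ρ.symm u)).2.2) he fun u v huv => ?_
  · have := (M (ρ.symm u)).2.1 v hv
    rwa [hρ'] at this
  · obtain ⟨d, hd⟩ := hδ ⟨(u, v), huv⟩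
    have h1 : π d.fst = u := congrArg (fun d : Γ.Dart => d.fst) hd
    have h2 : π d.snd = v := congrArg (fun d : Γ.Dart => d.snd) hd
    subst h1 h2
    rw [hρ, hρ]
    exact (hedge _ _ d.adj).2

end CFI

/-! ### The number of rounds -/

/-- A sufficient number of rounds in terms of the order of the group. -/
def meklerRounds (n : ℕ) : ℕ := 11 * Nat.log 2 (Nat.log 2 n) + 27

theorem meklerRounds_isBigO :
    (fun n : ℕ => (meklerRounds n : ℝ)) =O[Filter.atTop] fun n : ℕ => Real.log (Real.log n) := by
  have htend : Filter.Tendsto (fun n : ℕ => Real.log (Real.log n)) Filter.atTop Filter.atTop :=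
    Real.tendsto_log_atTop.comp (Real.tendsto_log_atTop.comp tendsto_natCast_atTop_atTop)
  have hlog2 : (0 : ℝ) < Real.log 2 := Real.log_pos (by norm_num)
  -- The factor 2 absorbs the constant `-Real.log (Real.log 2)`, which `h3` bounds by `Real.log
  -- (Real.log n)` for large `n`; `h1` absorbs the 27.
  refine Asymptotics.IsBigO.of_bound (11 * (2 / Real.log 2) + 27) ?_
  filter_upwards [htend.eventually_ge_atTop 1, Filter.eventually_ge_atTop 4,
    htend.eventually_ge_atTop (-Real.log (Real.log 2))] with n h1 h2 h3
  have hn : (1 : ℝ) < n := by exact_mod_cast (by omega : 1 < n)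
  have hlogn : 0 < Real.log n := Real.log_pos hn
  have ha : 0 < Nat.log 2 n := Nat.log_pos (by norm_num) (by omega)
  have hle : ((Nat.log 2 n : ℕ) : ℝ) ≤ Real.log n / Real.log 2 := by
    simpa [Real.logb] using Real.natLog_le_logb n 2
  have hle' : ((Nat.log 2 (Nat.log 2 n) : ℕ) : ℝ) ≤ 2 / Real.log 2 * Real.log (Real.log n) := by
    calc ((Nat.log 2 (Nat.log 2 n) : ℕ) : ℝ) ≤ Real.log (Nat.log 2 n : ℕ) / Real.log 2 := by
          simpa [Real.logb] using Real.natLog_le_logb (Nat.log 2 n) 2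
      _ ≤ Real.log (Real.log n / Real.log 2) / Real.log 2 := by
          gcongr
      _ = (Real.log (Real.log n) - Real.log (Real.log 2)) / Real.log 2 := by
          rw [Real.log_div hlogn.ne' hlog2.ne']
      _ ≤ (2 * Real.log (Real.log n)) / Real.log 2 := by
          gcongr
          linarith
      _ = 2 / Real.log 2 * Real.log (Real.log n) := by ring
  rw [Real.norm_of_nonneg (by positivity), Real.norm_of_nonneg (by linarith), meklerRounds]
  push_cast
  linarith

theorem exists_bounds {p n N : ℕ} (hp : 2 ≤ p) (hn : 0 < n) (h : p ^ n ≤ N) :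
    ∃ k l, n + 1 ≤ 2 ^ k ∧ p ≤ 2 ^ 2 ^ l ∧ 3 * l + 8 * k + 16 ≤ meklerRounds N := by
  have h1 : n < 2 ^ (Nat.log 2 n + 1) := Nat.lt_pow_succ_log_self (by norm_num) n
  have h2 : p < 2 ^ (Nat.log 2 p + 1) := Nat.lt_pow_succ_log_self (by norm_num) p
  have h3 : Nat.log 2 p < 2 ^ (Nat.log 2 (Nat.log 2 p) + 1) :=
    Nat.lt_pow_succ_log_self (by norm_num) _
  have h4 : n ≤ Nat.log 2 N :=
    Nat.le_log_of_pow_le (by norm_num) ((Nat.pow_le_pow_left hp n).trans h)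
  have h5 : Nat.log 2 p ≤ Nat.log 2 N :=
    Nat.log_mono_right ((Nat.le_self_pow hn.ne' p).trans h)
  have h6 : Nat.log 2 n ≤ Nat.log 2 (Nat.log 2 N) := Nat.log_mono_right h4
  have h7 : Nat.log 2 (Nat.log 2 p) ≤ Nat.log 2 (Nat.log 2 N) := Nat.log_mono_right h5
  -- Both logarithms are at most `Nat.log 2 (Nat.log 2 N)`, so the coefficients add up to 3 + 8 = 11
  -- and the constants to 3 + 8 + 16 = 27.
  refine ⟨Nat.log 2 n + 1, Nat.log 2 (Nat.log 2 p) + 1, h1,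
    h2.le.trans (Nat.pow_le_pow_right two_pos h3), ?_⟩
  rw [meklerRounds]
  omega

theorem MeklerGroup.groupWLIdentifies {X : Type u} [Finite X] [Nonempty X] {p : ℕ}
    [hp : Fact p.Prime] {Γ : SimpleGraph X} (hΓ : Γ.IsNice) (S : Skeleton Γ) {R : ℕ}
    (hR : meklerRounds (Nat.card (MeklerGroup p Γ)) ≤ R) :
    GroupWLIdentifies 3 R (MeklerGroup p Γ) := by
  intro H _ _ hH heq
  have := Fintype.ofFinite X
  obtain ⟨k, l, hk, hl, h⟩ := exists_bounds hp.out.two_le Fintype.card_pos (MeklerGroup.pow_card_le p Γ)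
  exact not_isEmpty_iff.2
    (MeklerGroup.nonempty_mulEquiv_of_wlColors_eq hΓ S hk hl (h.trans hR) heq) hH

theorem mainTheorem5 :
    ∃ f : ℕ → ℕ,
      (fun n : ℕ => (f n : ℝ)) =O[Filter.atTop] (fun n : ℕ => Real.log (Real.log n)) ∧
      ∀ (p : ℕ) [Fact p.Prime], 2 < p →
      ∀ (V : Type*) [Fintype V] (Γ₀ : SimpleGraph V) [Γ₀.LocallyFinite],
        Γ₀.IsRegularOfDegree 3 → Γ₀.Connected →
      ∀ e ∈ Γ₀.edgeSet,
        GroupWLDistinguishes 3 (f (Nat.card (MeklerGroup p (cfi Γ₀))))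
          (MeklerGroup p (cfi Γ₀)) (MeklerGroup p (twistedCfi Γ₀ e)) ∧
        ∀ r : ℕ, GraphWLIdentifies 3 r Γ₀ →
          GroupWLIdentifies 3 (max r (f (Nat.card (MeklerGroup p (cfi Γ₀)))))
            (MeklerGroup p (cfi Γ₀)) ∧
          GroupWLIdentifies 3 (max r (f (Nat.card (MeklerGroup p (twistedCfi Γ₀ e)))))
            (MeklerGroup p (twistedCfi Γ₀ e)) := by
  refine ⟨meklerRounds, meklerRounds_isBigO, fun p _ _ V _ Γ₀ _ hreg _ e he => ?_⟩
  have hΓ := hreg.isCubic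
  have hne : ∃ v v' : V, v ≠ v' := by
    induction e using Sym2.ind with
    | _ a b => exact ⟨a, b, SimpleGraph.Adj.ne he⟩
  obtain ⟨v, v', hvv'⟩ := hne
  have : Nonempty (CFIVertex Γ₀) := ⟨.inr ⟨(v, ∅), by simp, by simp⟩⟩
  have key : ∀ T R, meklerRounds (Nat.card (MeklerGroup p (cfiTwist Γ₀ T))) ≤ R →
      GroupWLIdentifies 3 R (MeklerGroup p (cfiTwist Γ₀ T)) := fun T R hR =>
    MeklerGroup.groupWLIdentifies (cfiTwist_isNice hΓ T) (nonempty_skeleton hΓ T hvv').some hR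
  refine ⟨key ∅ _ le_rfl _ ⟨fun φ => ?_⟩, fun r _ => ⟨key ∅ _ (le_max_right _ _),
    key {e} _ (le_max_right _ _)⟩⟩
  have := Fintype.ofFinite (CFIVertex Γ₀)
  obtain ⟨ψ⟩ := MeklerGroup.nonempty_iso_of_mulEquiv (cfiTwist_isNice hΓ ∅)
    (cfiTwist_isNice hΓ {e}) φ
  exact (isEmpty_cfi_iso_twistedCfi hΓ he).false ψ
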